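/- **Setting.** Let $k,d\ge 0$ be integers, $\alpha\in(0,\infty)$, and let $\mathbf X=(\mathbf X_{\mathbf t})_{\mathbf t\in\mathbb Z^k}$ be an $\mathbb R^d$-valued random field that is regularly varying with index $\alpha$: for every finite nonempty $S\subset\mathbb Z^k$ the random vector $\mathbf X_S=(\mathbf X_{\mathbf t})_{\mathbf t\in S}$ satisfies $\mathbb P(\|\mathbf X_S\|>xy)/\mathbb P(\|\mathbf X_S\|>x)\to y^{-\alpha}$ for all $y>0$, and $\mathbb P(x^{-1}\mathbf X_S\in\cdot)/\mathbb P(\|\mathbf X_S\|>x)$ converges as $x\to\infty$ to a nonzero measure on $(\mathbb R^d)^S\setminus\{\mathbf 0\}$ that is finite on sets bounded away from $\mathbf 0$ (convergence against bounded continuous functions vanishing near $\mathbf 0$), where $\|\mathbf z\|=\max_{\mathbf t\in S}|\mathbf z_{\mathbf t}|$. Assume that the marginal tails are comparable, $\mathbb P(|\mathbf X_{\mathbf s}|>x)=O(\mathbb P(|\mathbf X_{\mathbf t}|>x))$ as $x\to\infty$ for all $\mathbf s,\mathbf t\in\mathbb Z^k$; this holds automatically if $\mathbf X$ is stationary. Let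 $\rho:(\mathbb R^d)^{\mathbb Z^k}\to[0,\infty]$ be a modulus: $\rho(c\,\mathbf x)=c\,\rho(\mathbf x)$ for $c\ge0$ (with $0\cdot\infty=0$), and for every finite $\Upsilon\subset\mathbb Z^k$ the truncation $\rho_\Upsilon(\mathbf x):=\rho\big((\mathbf x_{\mathbf t}\mathbf 1(\mathbf t\in\Upsilon))_{\mathbf t\in\mathbb Z^k}\big)$ is finite and continuous, and vanishes only if $\mathbf x_{\mathbf t}=\mathbf 0$ for all $\mathbf t\in\Upsilon$. Write $(\Upsilon)_{\mathbf s}=\{\mathbf u+\mathbf s:\mathbf u\in\Upsilon\}$. Let $\Upsilon\subset\mathbb Z^k$ be finite and nonempty. **Statement.** (a) There is a random field $\mathbf Y_\Upsilon=(\mathbf Y_{\Upsilon,\mathbf t})_{\mathbf t\in\mathbb Z^k}$ in $\mathbb R^d$ (an $\Upsilon$-tail field of $\mathbf X$) with $\mathbb P(\rho_\Upsilon(\mathbf Y_\Upsilon)>y)=y^{-\alpha}$ for all $y\ge1$, such that as $x\to\infty$ $$\mathcal L\big(x^{-1}\mathbf X\,\big|\,\rho_\Upsilon(\mathbf X)>x\big)\to\mathcal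 L(\mathbf Y_\Upsilon)$$ in the sense of weak convergence of all finite-dimensional distributions. (b) There is a random field $\mathbf\Theta_\Upsilon=(\mathbf\Theta_{\Upsilon,\mathbf t})_{\mathbf t\in\mathbb Z^k}$ in $\mathbb R^d$ (an $\Upsilon$-spectral field of $\mathbf X$) such that, in the same sense, as $x\to\infty$ $$\mathcal L\big(\mathbf X/\rho_\Upsilon(\mathbf X)\,\big|\,\rho_\Upsilon(\mathbf X)>x\big)\to\mathcal L(\mathbf\Theta_\Upsilon).$$ (c) Let $\mathbf Y=\mathbf Y_\Upsilon$ be any $\Upsilon$-tail field of $\mathbf X$ (any random field, on any probability space, to which the convergence in (a) holds) and put $\mathbf\Theta_{\mathbf t}=\mathbf Y_{\mathbf t}/\rho_\Upsilon(\mathbf Y)$. Then $\mathbb P(\rho_\Upsilon(\mathbf Y)>y)=y^{-\alpha}$ for $y\ge1$, $\mathbf\Theta$ is an $\Upsilon$-spectral field of $\mathbf X$, and (i) $\rho_\Upsilon(\mathbf Y)$ is independent of $(\mathbf\Theta_{\mathbf t})_{\mathbf t\in\mathbb Z^k}$. Suppose in addition that $\mathbf X$ is stationary and that $\rho$ is translation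 invariant, $\rho((\mathbf x_{\mathbf t-\mathbf s})_{\mathbf t})=\rho((\mathbf x_{\mathbf t})_{\mathbf t})$ for all $\mathbf s\in\mathbb Z^k$. Then for every bounded measurable $g:(\mathbb R^d)^{\mathbb Z^k}\to\mathbb R$ and every $\mathbf s\in\mathbb Z^k$ (ii) $$\mathbb E\big[g\big((\mathbf Y_{\mathbf t-\mathbf s})_{\mathbf t}\big)\mathbf 1\big(\rho_{(\Upsilon)_{-\mathbf s}}(\mathbf Y)\ne0\big)\big]=\int_0^\infty\mathbb E\big[g\big((r\mathbf\Theta_{\mathbf t})_{\mathbf t}\big)\mathbf 1\big(r\rho_{(\Upsilon)_{\mathbf s}}(\mathbf\Theta)>1\big)\big]\,d(-r^{-\alpha}),$$ (iii) $$\mathbb E\big[g\big((\mathbf\Theta_{\mathbf t-\mathbf s})_{\mathbf t}\big)\mathbf 1\big(\rho_{(\Upsilon)_{-\mathbf s}}(\mathbf\Theta)\ne0\big)\big]=\mathbb E\Big[g\Big(\Big(\frac{\mathbf\Theta_{\mathbf t}}{\rho_{(\Upsilon)_{\mathbf s}}(\mathbf\Theta)}\Big)_{\mathbf t}\Big)\rho_{(\Upsilon)_{\mathbf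 s}}(\mathbf\Theta)^{\alpha}\Big],$$ where the integrand on the right of (iii) is $0$ when $\rho_{(\Upsilon)_{\mathbf s}}(\mathbf\Theta)=0$, and the integral on the right of (ii) and the expectation on the right of (iii) converge absolutely. -/

import Mathlib

open MeasureTheory ProbabilityTheory Filter Topology Asymptotics
open scoped ENNReal NNReal BoundedContinuousFunction

noncomputable section

namespace TailField

/-- The index set `ℤ^k`. -/
abbrev Idx (k : ℕ) : Type := Fin k → ℤ

/-- The value space `ℝ^d` with its Euclidean norm. -/
abbrev Val (d : ℕ) : Type := EuclideanSpace ℝ (Fin d)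

/-- The path space `(ℝ^d)^(ℤ^k)`, with the product topology and the product σ-algebra. -/
abbrev FieldPath (k d : ℕ) : Type := Idx k → Val d

/-! ### Regular variation and stationarity -/

/-- The random vector `Z` in the normed space `W` is regularly varying with index `α`:
its norm has a regularly varying tail of index `-α`, and `P(x⁻¹ Z ∈ ·) / P(‖Z‖ > x)` converges, as
`x → ∞`, to a nonzero measure `μ` on `W \ {0}` that is finite away from the origin. Convergence is
tested on the bounded continuous functions that vanish in a neighbourhood of the origin (no
condition at infinity, so that no mass is lost there). -/
def IsRegularlyVaryingVector {Ω W : Type*} [MeasurableSpace Ω] [NormedAddCommGroup W]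
    [NormedSpace ℝ W] [MeasurableSpace W] (P : Measure Ω) (Z : Ω → W) (α : ℝ) : Prop :=
  (∀ y : ℝ, 0 < y →
    Tendsto (fun x : ℝ => P.real {ω | x * y < ‖Z ω‖} / P.real {ω | x < ‖Z ω‖})
      atTop (𝓝 (y ^ (-α)))) ∧
  ∃ μ : Measure W, μ ≠ 0 ∧ μ {0} = 0 ∧ (∀ ε : ℝ, 0 < ε → μ {w | ε ≤ ‖w‖} < ∞) ∧
    ∀ f : W →ᵇ ℝ, (∃ ε : ℝ, 0 < ε ∧ ∀ w, ‖w‖ < ε → f w = 0) →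
      Tendsto (fun x : ℝ => (∫ ω, f (x⁻¹ • Z ω) ∂P) / P.real {ω | x < ‖Z ω‖})
        atTop (𝓝 (∫ w, f w ∂μ))

/-- The random field `X` is regularly varying with index `α`: so is every random vector
`(X_t)_{t ∈ S}` with `S` finite and nonempty. -/
def IsRegularlyVaryingField {Ω : Type*} [MeasurableSpace Ω] {k d : ℕ} (P : Measure Ω)
    (X : Idx k → Ω → Val d) (α : ℝ) : Prop :=
  ∀ S : Finset (Idx k), S.Nonempty →
    IsRegularlyVaryingVector P (fun ω (t : S) => X t ω) α

/-- Strict stationarity: all translates of the field have the same law. -/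
def IsStationaryField {Ω : Type*} [MeasurableSpace Ω] {k d : ℕ} (P : Measure Ω)
    (X : Idx k → Ω → Val d) : Prop :=
  ∀ s : Idx k, P.map (fun ω (t : Idx k) => X (t + s) ω) = P.map (fun ω (t : Idx k) => X t ω)

/-- The one-point marginal tails of the field are of the same order. Every stationary field has
this property, see `IsStationaryField.hasComparableTails`. -/
def HasComparableTails {Ω : Type*} [MeasurableSpace Ω] {k d : ℕ} (P : Measure Ω)
    (X : Idx k → Ω → Val d) : Prop :=
  ∀ s t : Idx k,
    (fun x : ℝ => P.real {ω | x < ‖X s ω‖}) =O[atTop] (fun x : ℝ => P.real {ω | x < ‖X t ω‖})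

theorem IsStationaryField.hasComparableTails {Ω : Type*} [MeasurableSpace Ω] {k d : ℕ}
    {P : Measure Ω} {X : Idx k → Ω → Val d} (hX : ∀ t, Measurable (X t))
    (h : IsStationaryField P X) : HasComparableTails P X := by
  intro s t
  have key : (fun x : ℝ => P.real {ω | x < ‖X s ω‖}) = fun x : ℝ => P.real {ω | x < ‖X t ω‖} := by
    funext x
    have hB : MeasurableSet {p : FieldPath k d | x < ‖p t‖} :=
      measurableSet_lt measurable_const (measurable_pi_apply t).norm
    have h1 := congrArg (fun ν : Measure (FieldPath k d) => ν {p : FieldPath k d | x < ‖p t‖})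
      (h (s - t))
    beta_reduce at h1
    rw [Measure.map_apply (measurable_pi_lambda _ fun u => hX (u + (s - t))) hB,
      Measure.map_apply (measurable_pi_lambda _ fun u => hX u) hB] at h1
    simp only [Set.preimage_ofPred_eq, add_sub_cancel] at h1
    simp only [Measure.real, h1]
  exact key ▸ isBigO_refl _ _

/-! ### Moduli -/

/-- The truncation of a field to the finite index set `Υ` (zero outside of `Υ`). -/
def trunc {k d : ℕ} (Υ : Finset (Idx k)) (x : FieldPath k d) : FieldPath k d :=
  Set.indicator (Υ : Set (Idx k)) x

/-- A modulus on `(ℝ^d)^(ℤ^k)`: a positively homogeneous functional which on each of the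
finite-dimensional spaces `(ℝ^d)^Υ` is finite, continuous, and zero only at the origin. It may take
the value `∞` on fields of infinite support, as do `sup_t |x_t|` and `(∑_t |x_t|^α)^(1/α)`. -/
structure IsModulus {k d : ℕ} (ρ : FieldPath k d → ℝ≥0∞) : Prop where
  homogeneous : ∀ (c : ℝ≥0) (x : FieldPath k d), ρ (fun t => (c : ℝ) • x t) = c * ρ x
  finite : ∀ (Υ : Finset (Idx k)) (x : FieldPath k d), ρ (trunc Υ x) ≠ ∞
  definite : ∀ (Υ : Finset (Idx k)) (x : FieldPath k d), ρ (trunc Υ x) = 0 → trunc Υ x = 0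
  continuous : ∀ Υ : Finset (Idx k), Continuous fun x : FieldPath k d => ρ (trunc Υ x)

/-- Invariance of `ρ` under the translations of `ℤ^k`. -/
def IsTranslationInvariant {k d : ℕ} (ρ : FieldPath k d → ℝ≥0∞) : Prop :=
  ∀ (s : Idx k) (x : FieldPath k d), ρ (fun t => x (t - s)) = ρ x

/-- The truncated modulus `ρ_Υ`, as a real number. -/
def truncModulus {k d : ℕ} (ρ : FieldPath k d → ℝ≥0∞) (Υ : Finset (Idx k)) (x : FieldPath k d) : ℝ :=
  (ρ (trunc Υ x)).toReal

/-- The translate `(Υ)_s = {u + s : u ∈ Υ}`. -/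
def translate {k : ℕ} (Υ : Finset (Idx k)) (s : Idx k) : Finset (Idx k) :=
  Υ.image fun u => u + s

/-! ### Tail fields and spectral fields -/

/-- The event `{ρ_Υ(X) > x}`. -/
def exceedance {Ω : Type*} {k d : ℕ} (X : Idx k → Ω → Val d) (ρ : FieldPath k d → ℝ≥0∞)
    (Υ : Finset (Idx k)) (x : ℝ) : Set Ω :=
  {ω | x < truncModulus ρ Υ fun t => X t ω}

/-- The normalized field `X / ρ_Υ(X)`. -/
def normalized {Ω : Type*} {k d : ℕ} (X : Idx k → Ω → Val d) (ρ : FieldPath k d → ℝ≥0∞)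
    (Υ : Finset (Idx k)) : Idx k → Ω → Val d :=
  fun t ω => (truncModulus ρ Υ fun u => X u ω)⁻¹ • X t ω

/-- `Y` is an `Υ`-tail field of `X`: the conditional law of `x⁻¹ X` given `ρ_Υ(X) > x` converges,
in the sense of the finite-dimensional distributions, to the law of `Y` as `x → ∞`. -/
def IsTailField {Ω Ω' : Type*} [MeasurableSpace Ω] [MeasurableSpace Ω'] {k d : ℕ}
    (P : Measure Ω) (X : Idx k → Ω → Val d) (ρ : FieldPath k d → ℝ≥0∞) (Υ : Finset (Idx k))
    (P' : Measure Ω') (Y : Idx k → Ω' → Val d) : Prop :=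
  (∀ t, Measurable (Y t)) ∧
  ∀ (T : Finset (Idx k)) (f : (T → Val d) →ᵇ ℝ),
    Tendsto (fun x : ℝ => ∫ ω, f (fun t : T => x⁻¹ • X t ω) ∂P[|exceedance X ρ Υ x])
      atTop (𝓝 (∫ ω', f (fun t : T => Y t ω') ∂P'))

/-- `Θ` is an `Υ`-spectral field of `X`: the conditional law of `X / ρ_Υ(X)` given `ρ_Υ(X) > x`
converges, in the sense of the finite-dimensional distributions, to the law of `Θ` as `x → ∞`. -/
def IsSpectralField {Ω Ω' : Type*} [MeasurableSpace Ω] [MeasurableSpace Ω'] {k d : ℕ}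
    (P : Measure Ω) (X : Idx k → Ω → Val d) (ρ : FieldPath k d → ℝ≥0∞) (Υ : Finset (Idx k))
    (P' : Measure Ω') (Θ : Idx k → Ω' → Val d) : Prop :=
  (∀ t, Measurable (Θ t)) ∧
  ∀ (T : Finset (Idx k)) (f : (T → Val d) →ᵇ ℝ),
    Tendsto (fun x : ℝ => ∫ ω, f (fun t : T => normalized X ρ Υ t ω) ∂P[|exceedance X ρ Υ x])
      atTop (𝓝 (∫ ω', f (fun t : T => Θ t ω') ∂P'))

/-- The measure `d(-r^(-α)) = α r^(-α-1) dr` on `(0, ∞)`. -/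
def powerMeasure (α : ℝ) : Measure ℝ :=
  (volume.restrict (Set.Ioi (0 : ℝ))).withDensity fun r => ENNReal.ofReal (α * r ^ (-α - 1))

end TailField

end

open TailField

/-! For finite `T ⊇ Υ`, the limit measure `μ` of `X_T` is homogeneous of order `-α`: replacing `x`
by `x / c` changes the normalization by a factor tending to `c ^ α`. On `(ℝ^d)^T` the modulus `ρ_Υ`
is continuous and positively homogeneous, so `{ρ_Υ > 1}` is bounded away from the origin.
Homogeneity makes `u ↦ μ {ρ_Υ > u}` a multiple of `u ^ (-α)`, so the level `{ρ_Υ = 1}` is null and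
the convergence may be restricted to `{ρ_Υ > 1}` (`IsRegularlyVaryingVector.exists_limit`).
Comparable tails give this set positive mass, so conditioning on it yields limit laws; they are
consistent as limits of consistent laws, and Kolmogorov extension provides the tail field.

Homogeneity passes to the law `Q` of any tail field: for `u ≥ 1`, `Q` restricted to `{ρ_Υ > u}` is
`u ^ (-α)` times the law of `u Y` (`IsTailField.restrict_eq`). Tested on the whole space this is the
Pareto law of `ρ_Υ(Y)`; tested on scale invariant events it is the independence of `ρ_Υ(Y)` and `Θ`
(`IsTailField.map_polar`). The spectral limit is a continuous mapping argument.

For the time change, consider the event `ρ_{Υ-s}(X) > ε x`, `ρ_Υ(X) > x`. Translation by `s` turns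
it into `ρ_Υ(X) > ε x`, `ρ_{Υ+s}(X) > x`, so the two conditions exchange roles. Stationarity and
passage to the limit show that the law of the translated `Y` on `{ρ_{Υ-s}(Y) > ε}` is `ε ^ (-α)`
times the law of `ε Y` on `{ε ρ_{Υ+s}(Y) > 1}` (`IsTailField.map_shiftPath_restrict`). By the polar
decomposition, `ε ^ (-α)` times the law of `ε Y` is the mixture of the laws of `r Θ` over `r > ε`
under `d(-r^(-α))`. Letting `ε` decrease to `0` gives (ii). Formula (iii) is (ii) applied to `g`
composed with normalization by `ρ_{Υ+s}`: then `r` enters only through `{r ρ_{Υ+s}(Θ) > 1}`, whose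
mass is `ρ_{Υ+s}(Θ) ^ α`. -/

/-! ### Integrals over superlevel sets via continuous cutoffs -/

/-- Piecewise linear cutoffs increase to the indicator of a superlevel set. -/
theorem tendsto_integral_cutoff {E : Type*} [MeasurableSpace E] {ν : Measure E} {f r : E → ℝ}
    (hf : Measurable f) (hr : Measurable r) {C : ℝ} (hC : ∀ z, |f z| ≤ C) {u : ℝ}
    (hν : ν {z | u < r z} ≠ ∞) :
    Tendsto (fun n : ℕ => ∫ z, max 0 (min 1 (n * (r z - u))) * f z ∂ν) atTop
      (𝓝 (∫ z in {z | u < r z}, f z ∂ν)) := by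
  have hA : MeasurableSet {z | u < r z} := measurableSet_lt measurable_const hr
  rw [← integral_indicator hA]
  refine tendsto_integral_of_dominated_convergence ({z | u < r z}.indicator fun _ => C) ?_ ?_ ?_ ?_
  · intro n
    exact (Measurable.mul (by fun_prop) hf).aestronglyMeasurable
  · rw [integrable_indicator_iff hA]
    exact integrableOn_const hν
  · intro n
    refine ae_of_all _ fun z => ?_
    by_cases hz : u < r z
    · have h0 : 0 ≤ C := (abs_nonneg _).trans (hC z)
      simp only [Set.indicator, Set.mem_ofPred_eq, hz, if_true]
      rw [norm_mul, Real.norm_eq_abs, Real.norm_eq_abs, abs_of_nonneg (le_max_left _ _)]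
      calc _ ≤ 1 * C := by
            gcongr
            · exact max_le zero_le_one (min_le_left _ _)
            · exact hC z
        _ = C := one_mul C
    · have h1 : (n : ℝ) * (r z - u) ≤ 0 :=
        mul_nonpos_of_nonneg_of_nonpos n.cast_nonneg (by linarith [not_lt.1 hz])
      simp only [Set.indicator, Set.mem_ofPred_eq, hz, if_false]
      rw [max_eq_left ((min_le_right _ _).trans h1)]
      simp
  · refine ae_of_all _ fun z => ?_
    by_cases hz : u < r z
    · obtain ⟨N, hN⟩ := exists_nat_ge (1 / (r z - u))
      refine tendsto_const_nhds.congr' ?_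
      filter_upwards [eventually_ge_atTop N] with n hn
      have h1 : 1 ≤ (n : ℝ) * (r z - u) := by
        rw [div_le_iff₀ (by linarith)] at hN
        refine hN.trans ?_
        have : (N : ℝ) ≤ n := by exact_mod_cast hn
        have h2 : 0 ≤ r z - u := by linarith
        gcongr
      simp [Set.indicator, hz, h1]
    · refine tendsto_const_nhds.congr fun n => ?_
      have h1 : (n : ℝ) * (r z - u) ≤ 0 :=
        mul_nonpos_of_nonneg_of_nonpos n.cast_nonneg (by linarith [not_lt.1 hz])
      simp only [Set.indicator, Set.mem_ofPred_eq, hz, if_false]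
      rw [max_eq_left ((min_le_right _ _).trans h1)]
      simp

/-- If the integrals of continuous cutoffs of `f` and of `1` along `r` converge, then so do the
integrals of `f` over superlevel sets of `r` whose boundary level is not charged by the limit. -/
theorem tendsto_setIntegral_of_cutoff {E ι : Type*} [MeasurableSpace E] {l : Filter ι}
    {m : ι → Measure E} [∀ i, IsFiniteMeasure (m i)] {ν : Measure E} [IsFiniteMeasure ν]
    {f r : E → ℝ} (hf : Measurable f) (hr : Measurable r) {C : ℝ} (hC : ∀ z, |f z| ≤ C)
    {ε u : ℝ} (hεu : ε < u) (hν : ν {z | r z = u} = 0)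
    (h1 : ∀ φ : ℝ → ℝ, Continuous φ → (∀ t, |φ t| ≤ 1) → (∀ t ≤ ε, φ t = 0) →
      Tendsto (fun i => ∫ z, φ (r z) ∂m i) l (𝓝 (∫ z, φ (r z) ∂ν)))
    (hf1 : ∀ φ : ℝ → ℝ, Continuous φ → (∀ t, |φ t| ≤ 1) → (∀ t ≤ ε, φ t = 0) →
      Tendsto (fun i => ∫ z, φ (r z) * f z ∂m i) l (𝓝 (∫ z, φ (r z) * f z ∂ν))) :
    Tendsto (fun i => ∫ z in {z | u < r z}, f z ∂m i) l (𝓝 (∫ z in {z | u < r z}, f z ∂ν)) := by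
  have hA : MeasurableSet {z | u < r z} := measurableSet_lt measurable_const hr
  -- `φ n` climbs from `0` at `u` to `1` at `u + 1/n`. It differs from the indicator of `(u, ∞)`
  -- only within `1/n` of `u`, where the bump `κ n` equals `1`; so `C * ∫ κ n (r z)` bounds the
  -- error for every finite measure at once.
  let φ : ℕ → ℝ → ℝ := fun n t => max 0 (min 1 (n * (t - u)))
  let κ : ℕ → ℝ → ℝ := fun n t => max 0 (min 1 (2 - n * |t - u|))
  have hφc : ∀ n, Continuous (φ n) := fun n => by fun_prop
  have hκc : ∀ n, Continuous (κ n) := fun n => by fun_prop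
  have hφ0 : ∀ n t, 0 ≤ φ n t := fun n t => le_max_left _ _
  have hκ0 : ∀ n t, 0 ≤ κ n t := fun n t => le_max_left _ _
  have hφ1 : ∀ n t, φ n t ≤ 1 := fun n t => max_le zero_le_one (min_le_left _ _)
  have hκ1 : ∀ n t, κ n t ≤ 1 := fun n t => max_le zero_le_one (min_le_left _ _)
  have hφz : ∀ n t, t ≤ u → φ n t = 0 := fun n t ht =>
    max_eq_left ((min_le_right _ _).trans
      (mul_nonpos_of_nonneg_of_nonpos n.cast_nonneg (by linarith)))
  have hκz : ∀ (n : ℕ) (t : ℝ), 2 ≤ n * |t - u| → κ n t = 0 := fun n t ht =>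
    max_eq_left ((min_le_right _ _).trans (by linarith))
  have hκint : ∀ n (m' : Measure E) [IsFiniteMeasure m'], Integrable (fun z => κ n (r z)) m' := by
    intro n m' _
    refine Integrable.of_bound ((hκc n).measurable.comp hr).aestronglyMeasurable 1
      (ae_of_all _ fun z => ?_)
    rw [Real.norm_eq_abs, abs_of_nonneg (hκ0 _ _)]
    exact hκ1 _ _
  have hbound : ∀ n (m' : Measure E) [IsFiniteMeasure m'],
      |∫ z in {z | u < r z}, f z ∂m' - ∫ z, φ n (r z) * f z ∂m'| ≤ C * ∫ z, κ n (r z) ∂m' := by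
    intro n m' _
    have hfi : Integrable f m' := Integrable.of_bound hf.aestronglyMeasurable C
      (ae_of_all _ fun z => hC z)
    have hφfi : Integrable (fun z => φ n (r z) * f z) m' := by
      refine Integrable.of_bound (((hφc n).measurable.comp hr).mul hf).aestronglyMeasurable C
        (ae_of_all _ fun z => ?_)
      rw [norm_mul, Real.norm_eq_abs, abs_of_nonneg (hφ0 _ _)]
      have := hC z
      have h2 := hφ1 n (r z)
      have h3 := hφ0 n (r z)
      rw [Real.norm_eq_abs]
      nlinarith [abs_nonneg (f z)]
    rw [← integral_indicator hA, ← integral_sub (hfi.indicator hA) hφfi, ← Real.norm_eq_abs,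
      ← integral_const_mul]
    refine norm_integral_le_of_norm_le ((hκint n m').const_mul C) (ae_of_all _ fun z => ?_)
    have hC0 : 0 ≤ C := (abs_nonneg _).trans (hC z)
    rw [Real.norm_eq_abs]
    by_cases hz : u < r z
    · simp only [Set.indicator, Set.mem_ofPred_eq, hz, if_true]
      have h4 : 1 - φ n (r z) ≤ κ n (r z) := by
        by_cases h5 : (n : ℝ) * (r z - u) ≤ 1
        · have h6 : κ n (r z) = 1 := by
            have : 1 ≤ 2 - (n : ℝ) * |r z - u| := by
              rw [abs_of_pos (by linarith)]; linarith
            simp only [κ]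
            rw [min_eq_left this, max_eq_right zero_le_one]
          rw [h6]; linarith [hφ0 n (r z)]
        · have h6 : φ n (r z) = 1 := by
            simp only [φ]
            rw [min_eq_left (not_le.1 h5).le, max_eq_right zero_le_one]
          rw [h6]; linarith [hκ0 n (r z)]
      have h7 : f z - φ n (r z) * f z = (1 - φ n (r z)) * f z := by ring
      rw [h7, abs_mul, abs_of_nonneg (by linarith [hφ1 n (r z)]), mul_comm]
      exact mul_le_mul (hC z) h4 (by linarith [hφ1 n (r z)]) hC0
    · simp only [Set.indicator, Set.mem_ofPred_eq, hz, if_false]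
      rw [hφz n _ (not_lt.1 hz)]
      simpa using mul_nonneg hC0 (hκ0 n (r z))
  have hκlim : Tendsto (fun n => C * ∫ z, κ n (r z) ∂ν) atTop (𝓝 0) := by
    have : Tendsto (fun n => ∫ z, κ n (r z) ∂ν) atTop (𝓝 (∫ _, (0 : ℝ) ∂ν)) := by
      refine tendsto_integral_of_dominated_convergence (fun _ => (1 : ℝ))
        (fun n => ((hκc n).measurable.comp hr).aestronglyMeasurable) (integrable_const _)
        (fun n => ae_of_all _ fun z => ?_) ?_
      · rw [Real.norm_eq_abs, abs_of_nonneg (hκ0 _ _)]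
        exact hκ1 _ _
      · have : ∀ᵐ z ∂ν, r z ≠ u := by
          rw [ae_iff]; simpa using hν
        filter_upwards [this] with z hz
        have hpos : 0 < |r z - u| := abs_pos.2 (sub_ne_zero.2 hz)
        obtain ⟨N, hN⟩ := exists_nat_ge (2 / |r z - u|)
        refine tendsto_const_nhds.congr' ?_
        filter_upwards [eventually_ge_atTop N] with n hn
        rw [div_le_iff₀ hpos] at hN
        refine (hκz n _ (hN.trans ?_)).symm
        have : (N : ℝ) ≤ n := by exact_mod_cast hn
        gcongr
    simpa using this.const_mul C
  rw [Metric.tendsto_nhds]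
  intro δ hδ
  -- The bump has radius `2/n` around `u`, so `n ≥ 2 / (u - ε)` makes it vanish below `ε`, hence an
  -- admissible test function. Two cutoff errors and one convergence error, each below `δ / 4`, are
  -- then added.
  obtain ⟨N, hN⟩ := exists_nat_ge (2 / (u - ε))
  obtain ⟨n, hn1, hn2⟩ := ((hκlim.eventually_lt_const (show (0 : ℝ) < δ / 4 by linarith)).and
    (eventually_ge_atTop N)).exists
  have hκv : ∀ t ≤ ε, κ n t = 0 := by
    intro t ht
    refine hκz n t ?_
    rw [div_le_iff₀ (by linarith)] at hN
    refine hN.trans ?_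
    have h8 : (N : ℝ) ≤ n := by exact_mod_cast hn2
    rw [abs_of_nonpos (by linarith)]
    have h9 : u - ε ≤ -(t - u) := by linarith
    have h10 : 0 ≤ u - ε := by linarith
    gcongr
  have e1 := (h1 (κ n) (hκc n) (fun t => by rw [abs_of_nonneg (hκ0 _ _)]; exact hκ1 _ _)
    hκv).const_mul C
  have e2 := hf1 (φ n) (hφc n) (fun t => by rw [abs_of_nonneg (hφ0 _ _)]; exact hφ1 _ _)
    (fun t ht => hφz n t (ht.trans hεu.le))
  have e3 := (Metric.tendsto_nhds.1 e2) (δ / 4) (by linarith)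
  filter_upwards [e1.eventually_lt_const hn1, e3] with i hi1 hi2
  have b1 := hbound n (m i)
  have b2 := hbound n ν
  rw [Real.dist_eq] at hi2 ⊢
  rw [abs_le] at b1 b2
  rw [abs_lt] at hi2 ⊢
  constructor <;> linarith [b1.1, b1.2, b2.1, b2.2, hi2.1, hi2.2]

/-! ### Regular variation with respect to a homogeneous functional -/

/-- A continuous positively homogeneous functional vanishes at the origin. -/
theorem map_zero_of_posHomogeneous {W : Type*} [NormedAddCommGroup W] [NormedSpace ℝ W]
    {r : W → ℝ} (hrh : ∀ c : ℝ, 0 < c → ∀ w, r (c • w) = c * r w) : r 0 = 0 := by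
  have := hrh 2 two_pos 0
  rw [smul_zero] at this
  linarith

/-- Continuity at the origin, where `r` vanishes. It keeps `{u ≤ r}` away from the origin, so that
this set has finite limit measure and functions supported there are legitimate test functions. -/
theorem exists_lt_of_norm_lt {W : Type*} [NormedAddCommGroup W] [NormedSpace ℝ W]
    {r : W → ℝ} (hrc : Continuous r) (hrh : ∀ c : ℝ, 0 < c → ∀ w, r (c • w) = c * r w)
    {u : ℝ} (hu : 0 < u) : ∃ δ : ℝ, 0 < δ ∧ ∀ w, ‖w‖ < δ → r w < u := by
  have h0 : r 0 < u := by rw [map_zero_of_posHomogeneous hrh]; exact hu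
  have := hrc.continuousAt.eventually_lt_const h0
  obtain ⟨δ, hδ, h⟩ := Metric.eventually_nhds_iff.1 this
  exact ⟨δ, hδ, fun w hw => h (by simpa using hw)⟩

/-- A bounded continuous function out of a continuous function with an explicit bound. -/
noncomputable def bcfOfBound {W : Type*} [TopologicalSpace W] (f : W → ℝ) (hf : Continuous f) {C : ℝ}
    (hC : ∀ w, |f w| ≤ C) : W →ᵇ ℝ :=
  BoundedContinuousFunction.ofNormedAddCommGroup f hf C hC

@[simp] theorem bcfOfBound_apply {W : Type*} [TopologicalSpace W] (f : W → ℝ) (hf : Continuous f)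
    {C : ℝ} (hC : ∀ w, |f w| ≤ C) (w : W) : bcfOfBound f hf hC w = f w := rfl

theorem abs_cutoff_le_one (t : ℝ) : |max 0 (min 1 t)| ≤ 1 := by
  rw [abs_of_nonneg (le_max_left _ _)]
  exact max_le zero_le_one (min_le_left _ _)

/-- Conditional limit law of a regularly varying vector, with respect to a continuous positively
homogeneous functional `r` in place of the norm. -/
theorem TailField.IsRegularlyVaryingVector.exists_limit {Ω W : Type*} [MeasurableSpace Ω]
    [NormedAddCommGroup W] [NormedSpace ℝ W] [MeasurableSpace W] [BorelSpace W]
    {P : Measure Ω} [IsProbabilityMeasure P] {Z : Ω → W} (hZ : Measurable Z) {α : ℝ}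
    (h : IsRegularlyVaryingVector P Z α) {r : W → ℝ} (hrc : Continuous r)
    (hrh : ∀ c : ℝ, 0 < c → ∀ w, r (c • w) = c * r w) :
    ∃ μ : Measure W, (∀ u : ℝ, 0 < u → μ {w | u < r w} ≠ ∞) ∧
      (∀ u : ℝ, 0 < u → (μ.restrict {w | 1 < r w}).map (fun w => u • w) =
        ENNReal.ofReal (u ^ α) • μ.restrict {w | u < r w}) ∧
      ∀ f : W →ᵇ ℝ, Tendsto (fun x : ℝ => (∫ ω in {ω | x < r (Z ω)}, f (x⁻¹ • Z ω) ∂P) /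
        P.real {ω | x < ‖Z ω‖}) atTop (𝓝 (∫ w in {w | 1 < r w}, f w ∂μ)) := by
  obtain ⟨htail, μ, -, -, hfin, hconv⟩ := h
  have hr : Measurable r := hrc.measurable
  have hA : ∀ u : ℝ, MeasurableSet {w | u < r w} := fun u => measurableSet_lt measurable_const hr
  have hfinr : ∀ u : ℝ, 0 < u → μ {w | u ≤ r w} < ∞ := by
    intro u hu
    obtain ⟨δ, hδ, hlt⟩ := exists_lt_of_norm_lt hrc hrh hu
    refine (measure_mono fun w hw => ?_).trans_lt (hfin δ hδ)
    by_contra hc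
    exact absurd (hlt w (not_le.1 hc)) (not_lt.2 hw)
  have hfinl : ∀ u : ℝ, 0 < u → μ {w | u < r w} ≠ ∞ := fun u hu =>
    ((measure_mono fun w (hw : u < r w) => hw.le).trans_lt (hfinr u hu)).ne
  -- Since `0 / 0 = 0`, convergence of the trivial ratio (`y = 1`) to `1` excludes a vanishing tail.
  have hpos : ∀ᶠ x in atTop, P.real {ω | x < ‖Z ω‖} ≠ 0 := by
    have h1 := htail 1 one_pos
    rw [Real.one_rpow] at h1
    filter_upwards [h1.eventually_ne one_ne_zero] with x hx h0
    exact hx (by rw [h0, div_zero])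
  -- homogeneity on test functions
  have hhom : ∀ (f : W →ᵇ ℝ) (c : ℝ), 0 < c → (∃ ε : ℝ, 0 < ε ∧ ∀ w, ‖w‖ < ε → f w = 0) →
      ∫ w, f (c • w) ∂μ = c ^ α * ∫ w, f w ∂μ := by
    intro f c hc hf
    obtain ⟨ε, hε, hf0⟩ := hf
    let fc : W →ᵇ ℝ := f.compContinuous ⟨fun w => c • w, by fun_prop⟩
    have t1 := hconv fc ⟨ε / c, by positivity, fun w hw => by
      refine hf0 _ ?_
      simp only [ContinuousMap.coe_mk]
      rw [norm_smul, Real.norm_eq_abs, abs_of_pos hc]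
      rwa [lt_div_iff₀ hc, mul_comm] at hw⟩
    have hdiv : Tendsto (fun x : ℝ => x * c⁻¹) atTop atTop :=
      tendsto_id.atTop_mul_const (inv_pos.2 hc)
    have t2 := (hconv f ⟨ε, hε, hf0⟩).comp hdiv
    -- Evaluating `f (c • x⁻¹ • Z)` at `x` is evaluating `f` at scale `x / c`; the change of
    -- normalization has limit `c⁻¹ ^ (-α) = c ^ α`.
    have t3 := t2.mul (htail c⁻¹ (inv_pos.2 hc))
    have t4 := tendsto_nhds_unique (t1.congr' ?_) t3
    · have : c⁻¹ ^ (-α) = c ^ α := by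
        rw [Real.inv_rpow hc.le, Real.rpow_neg hc.le, inv_inv]
      rw [this, mul_comm] at t4
      exact t4
    · filter_upwards [hdiv.eventually hpos] with x hx
      simp only [Function.comp_apply]
      rw [div_mul_div_cancel₀ hx]
      congr 2
      funext ω
      simp only [fc, BoundedContinuousFunction.compContinuous_apply, ContinuousMap.coe_mk]
      rw [smul_smul, mul_inv, inv_inv, mul_comm]
  -- homogeneity on superlevel sets
  have hhomr : ∀ (f : W →ᵇ ℝ) (u : ℝ), 0 < u →
      ∫ w in {w | 1 < r w}, f (u • w) ∂μ = u ^ α * ∫ w in {w | u < r w}, f w ∂μ := by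
    intro f u hu
    have hfC : ∀ w, |f w| ≤ ‖f‖ := fun w => f.norm_coe_le_norm w
    have l1 := tendsto_integral_cutoff (ν := μ) (f := fun w => f (u • w)) (r := r) (u := 1)
      (by fun_prop) hr (fun w => hfC _) (hfinl 1 one_pos)
    -- The cutoff uses `u⁻¹ * r` at level `1` rather than `r` at level `u`, so that dilation by `u`
    -- carries it exactly to the cutoff of `l1`, for each `n`.
    have l2 := tendsto_integral_cutoff (ν := μ) (f := f) (r := fun w => u⁻¹ * r w) (u := 1)
      (by fun_prop) (by fun_prop) hfC (by
        convert hfinl u hu using 4 with w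
        rw [inv_mul_eq_div, one_lt_div hu])
    have hset : {w | 1 < u⁻¹ * r w} = {w | u < r w} := by
      ext w
      simp only [Set.mem_ofPred_eq]
      rw [inv_mul_eq_div, one_lt_div hu]
    rw [hset] at l2
    refine tendsto_nhds_unique l1 ((l2.const_mul (u ^ α)).congr fun n => ?_)
    have hb : ∀ w, |max 0 (min 1 ((n : ℝ) * (u⁻¹ * r w - 1))) * f w| ≤ 1 * ‖f‖ := by
      intro w
      rw [abs_mul]
      exact mul_le_mul (abs_cutoff_le_one _) (hfC w) (abs_nonneg _) zero_le_one
    have := hhom (bcfOfBound (fun w => max 0 (min 1 ((n : ℝ) * (u⁻¹ * r w - 1))) * f w)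
      (by fun_prop) hb) u hu ?_
    · simp only [bcfOfBound_apply, hrh u hu, inv_mul_cancel_left₀ hu.ne'] at this
      exact this.symm
    · obtain ⟨δ, hδ, hlt⟩ := exists_lt_of_norm_lt hrc hrh hu
      refine ⟨δ, hδ, fun w hw => ?_⟩
      have h1 : (n : ℝ) * (u⁻¹ * r w - 1) ≤ 0 := by
        refine mul_nonpos_of_nonneg_of_nonpos n.cast_nonneg ?_
        rw [inv_mul_eq_div, sub_nonpos, div_le_one hu]
        exact (hlt w hw).le
      simp only [bcfOfBound_apply]
      rw [max_eq_left ((min_le_right _ _).trans h1), zero_mul]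
  have hmeas : ∀ u : ℝ, 0 < u → (μ.restrict {w | 1 < r w}).map (fun w => u • w) =
        ENNReal.ofReal (u ^ α) • μ.restrict {w | u < r w} := by
    intro u hu
    have i1 : IsFiniteMeasure (μ.restrict {w | 1 < r w}) :=
      isFiniteMeasure_restrict.2 (hfinl 1 one_pos)
    have i2 : IsFiniteMeasure (μ.restrict {w | u < r w}) :=
      isFiniteMeasure_restrict.2 (hfinl u hu)
    have i3 : IsFiniteMeasure (ENNReal.ofReal (u ^ α) • μ.restrict {w | u < r w}) :=
      Measure.smul_finite _ ENNReal.ofReal_ne_top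
    have hm : Measurable fun w : W => u • w := (continuous_const_smul u).measurable
    refine ext_of_forall_integral_eq_of_IsFiniteMeasure fun f => ?_
    rw [integral_map hm.aemeasurable f.continuous.measurable.aestronglyMeasurable,
      integral_smul_measure, ENNReal.toReal_ofReal (by positivity), smul_eq_mul]
    exact hhomr f u hu
  -- the boundary is not charged
  have hbd : μ {w | r w = 1} = 0 := by
    have hψ : ∀ u : ℝ, 0 < u → μ {w | u < r w} = ENNReal.ofReal (u ^ (-α)) * μ {w | 1 < r w} := by
      intro u hu
      have h1 := congrArg (fun m : Measure W => m Set.univ) (hmeas u hu)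
      have hm : Measurable fun w : W => u • w := (continuous_const_smul u).measurable
      simp only [Measure.smul_apply, smul_eq_mul, Measure.restrict_apply_univ] at h1
      rw [Measure.map_apply hm MeasurableSet.univ, Set.preimage_univ,
        Measure.restrict_apply_univ] at h1
      rw [h1, ← mul_assoc, ← ENNReal.ofReal_mul (by positivity), ← Real.rpow_add hu]
      simp
    -- For `u < 1` the closed set lies in `{u < r}`, of mass `u ^ (-α) * μ {1 < r}`; let `u`
    -- increase to `1`.
    have hle : μ {w | 1 ≤ r w} ≤ μ {w | 1 < r w} := by
      have hcont : Tendsto (fun u : ℝ => ENNReal.ofReal (u ^ (-α)) * μ {w | 1 < r w})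
          (𝓝[<] 1) (𝓝 (ENNReal.ofReal ((1 : ℝ) ^ (-α)) * μ {w | 1 < r w})) := by
        refine ENNReal.Tendsto.mul_const ?_ (Or.inr (hfinl 1 one_pos))
        refine (ENNReal.continuous_ofReal.tendsto _).comp ?_
        exact ((Real.continuousAt_rpow_const 1 (-α) (Or.inl one_ne_zero)).tendsto).mono_left
          nhdsWithin_le_nhds
      rw [Real.one_rpow, ENNReal.ofReal_one, one_mul] at hcont
      refine ge_of_tendsto hcont ?_
      have : ∀ᶠ u : ℝ in 𝓝[<] 1, 0 < u :=
        nhdsWithin_le_nhds (lt_mem_nhds (zero_lt_one : (0 : ℝ) < 1))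
      filter_upwards [this, self_mem_nhdsWithin] with u hu hu1
      rw [← hψ u hu]
      exact measure_mono fun w (hw : 1 ≤ r w) => lt_of_lt_of_le (Set.mem_Iio.1 hu1) hw
    have hd : μ ({w | 1 ≤ r w} \ {w | 1 < r w}) = 0 := by
      have hsub : {w | 1 < r w} ⊆ {w | 1 ≤ r w} := fun w (hw : 1 < r w) => hw.le
      rw [measure_sdiff hsub (hA 1).nullMeasurableSet
        (hfinl 1 one_pos)]
      exact tsub_eq_zero_of_le hle
    refine measure_mono_null (fun w (hw : r w = 1) => ?_) hd
    exact ⟨hw.ge, by simp [hw]⟩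
  refine ⟨μ, hfinl, hmeas, fun f => ?_⟩
  have hfC : ∀ w, |f w| ≤ ‖f‖ := fun w => f.norm_coe_le_norm w
  let p : ℝ → ℝ := fun x => P.real {ω | x < ‖Z ω‖}
  have hm : ∀ x : ℝ, Measurable fun ω => x⁻¹ • Z ω := fun x =>
    (continuous_const_smul x⁻¹).measurable.comp hZ
  -- Where the tail `p x` vanishes, `(p x)⁻¹ = 0`, so `m x` is a finite measure for every `x`.
  let m : ℝ → Measure W := fun x => ENNReal.ofReal (p x)⁻¹ • P.map fun ω => x⁻¹ • Z ω
  have hmf : ∀ x, IsFiniteMeasure (m x) := fun x => Measure.smul_finite _ ENNReal.ofReal_ne_top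
  have hp0 : ∀ x, 0 ≤ (p x)⁻¹ := fun x => inv_nonneg.2 measureReal_nonneg
  have hmi : ∀ (x : ℝ) (g : W → ℝ), Measurable g →
      ∫ w, g w ∂(m x) = (∫ ω, g (x⁻¹ • Z ω) ∂P) / p x := by
    intro x g hg
    rw [integral_smul_measure, integral_map (hm x).aemeasurable hg.aestronglyMeasurable,
      ENNReal.toReal_ofReal (hp0 x), smul_eq_mul, div_eq_inv_mul]
  -- `μ` may be infinite near the origin. Any level in `(0, 1)` would do: the cutoffs at level `1`
  -- live above it and the restricted measure is finite.
  have hν : IsFiniteMeasure (μ.restrict {w | 1 / 2 < r w}) :=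
    isFiniteMeasure_restrict.2 (hfinl _ one_half_pos)
  have key : ∀ (g : W →ᵇ ℝ) (φ : ℝ → ℝ), Continuous φ → (∀ t, |φ t| ≤ 1) →
      (∀ t ≤ 1 / 2, φ t = 0) → Tendsto (fun x => ∫ w, φ (r w) * g w ∂(m x)) atTop
        (𝓝 (∫ w, φ (r w) * g w ∂(μ.restrict {w | 1 / 2 < r w}))) := by
    intro g φ hφ hφ1 hφ0
    have hb : ∀ w, |φ (r w) * g w| ≤ 1 * ‖g‖ := by
      intro w
      rw [abs_mul]
      exact mul_le_mul (hφ1 _) (g.norm_coe_le_norm w) (abs_nonneg _) zero_le_one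
    obtain ⟨δ, hδ, hlt⟩ := exists_lt_of_norm_lt hrc hrh one_half_pos
    have := hconv (bcfOfBound (fun w => φ (r w) * g w) (by fun_prop) hb) ⟨δ, hδ, fun w hw => by
      rw [bcfOfBound_apply, hφ0 _ (hlt w hw).le, zero_mul]⟩
    rw [setIntegral_eq_integral_of_forall_compl_eq_zero (fun w hw => by
      rw [hφ0 _ (not_lt.1 hw), zero_mul])]
    refine this.congr fun x => ?_
    rw [hmi x _ (by fun_prop)]
    rfl
  have hmain := tendsto_setIntegral_of_cutoff (l := atTop) (m := m)
    (ν := μ.restrict {w | 1 / 2 < r w}) (f := f) (r := r) (by fun_prop) hr hfC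
    (show (1 / 2 : ℝ) < 1 by norm_num)
    (le_antisymm ((Measure.restrict_apply_le _ _).trans hbd.le) zero_le)
    (fun φ h1 h2 h3 => by simpa using key (BoundedContinuousFunction.const W 1) φ h1 h2 h3)
    (key f)
  have hsub : {w | 1 < r w} ⊆ {w | 1 / 2 < r w} := fun w (hw : 1 < r w) =>
    (by norm_num : (1 / 2 : ℝ) < 1).trans hw
  rw [Measure.restrict_restrict (hA 1), Set.inter_eq_self_of_subset_left hsub] at hmain
  refine hmain.congr' ?_
  filter_upwards [eventually_gt_atTop 0] with x hx
  rw [← integral_indicator (hA 1), hmi x _ (Measurable.indicator (by fun_prop) (hA 1))]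
  have hB : MeasurableSet {ω | x < r (Z ω)} := measurableSet_lt measurable_const (hr.comp hZ)
  rw [← integral_indicator hB]
  congr 2
  funext ω
  have hiff : 1 < r (x⁻¹ • Z ω) ↔ x < r (Z ω) := by
    rw [hrh _ (inv_pos.2 hx), inv_mul_eq_div, one_lt_div hx]
  by_cases hω : x < r (Z ω)
  · simp [Set.indicator, hω, hiff]
  · simp [Set.indicator, hω, hiff]

/-! ### Projective limits and measures on countable products -/

/-- Extension of a finite family to the whole index set by a constant. -/
def constExt {ι E : Type*} (e : E) (T : Finset ι) [DecidableEq ι] (z : T → E) : ι → E :=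
  fun t => if h : t ∈ T then z ⟨t, h⟩ else e

theorem continuous_constExt {ι E : Type*} [TopologicalSpace E] (e : E) (T : Finset ι)
    [DecidableEq ι] : Continuous (constExt e T) := by
  refine continuous_pi fun t => ?_
  by_cases h : t ∈ T
  · simpa [constExt, h] using continuous_apply _
  · simpa [constExt, h] using continuous_const

theorem constExt_of_mem {ι E : Type*} (e : E) {T : Finset ι} [DecidableEq ι] (z : T → E) {t : ι}
    (h : t ∈ T) : constExt e T z t = z ⟨t, h⟩ := by
  simp [constExt, h]

/-- **Kolmogorov extension** for countable families of copies of a Polish space. -/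
theorem exists_isProjectiveLimit {ι E : Type*} [Countable ι] [TopologicalSpace E] [PolishSpace E]
    [MeasurableSpace E] [BorelSpace E] [Nonempty E] (ν : ∀ T : Finset ι, Measure (T → E))
    [∀ T, IsProbabilityMeasure (ν T)] (hν : IsProjectiveMeasureFamily (α := fun _ => E) ν) :
    ∃ Q : Measure (ι → E), IsProjectiveLimit (α := fun _ => E) Q ν := by
  classical
  obtain ⟨e⟩ := ‹Nonempty E›
  have hem : ∀ T : Finset ι, Measurable (constExt e T) := fun T =>
    (continuous_constExt e T).measurable
  -- Each `ν T` is placed on the whole product by filling in `e`. These laws are tight, and any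
  -- cluster point has the right marginals: once `I ⊆ T`, the marginal of `π T` on `I` is already `ν
  -- I`.
  let π : Finset ι → ProbabilityMeasure (ι → E) := fun T =>
    ⟨(ν T).map (constExt e T), Measure.isProbabilityMeasure_map (hem T).aemeasurable⟩
  -- one-dimensional marginals
  have hmarg : ∀ (T : Finset ι) (t : ι) (ht : t ∈ T) (A : Set E), MeasurableSet A →
      ν T {z | z ⟨t, ht⟩ ∈ A} = ν {t} {z | z ⟨t, Finset.mem_singleton_self t⟩ ∈ A} := by
    intro T t ht A hA
    have hsub : ({t} : Finset ι) ⊆ T := by simpa using ht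
    have hm : MeasurableSet {z : ({t} : Finset ι) → E | z ⟨t, Finset.mem_singleton_self t⟩ ∈ A} :=
      measurable_pi_apply _ hA
    rw [hν T {t} hsub]
    exact (Measure.map_apply (Finset.measurable_restrict₂ (X := fun _ => E) hsub) hm).symm
  have htight : IsTightMeasureSet {((μ : ProbabilityMeasure (ι → E)) : Measure (ι → E)) |
      μ ∈ Set.range π} := by
    rw [isTightMeasureSet_iff_exists_isCompact_measure_compl_le]
    intro ε hε
    obtain ⟨w, hw0, hws⟩ := ENNReal.exists_pos_sum_of_countable' hε.ne' ι
    have hK : ∀ t : ι, ∃ K : Set E, IsCompact K ∧ e ∈ K ∧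
        ν {t} {z | z ⟨t, Finset.mem_singleton_self t⟩ ∈ Kᶜ} ≤ w t := by
      intro t
      let _ := TopologicalSpace.upgradeIsCompletelyMetrizable E
      have hm : Measurable fun z : ({t} : Finset ι) → E => z ⟨t, Finset.mem_singleton_self t⟩ :=
        measurable_pi_apply _
      have hp : IsProbabilityMeasure ((ν {t}).map fun z => z ⟨t, Finset.mem_singleton_self t⟩) :=
        Measure.isProbabilityMeasure_map hm.aemeasurable
      have h1 := isTightMeasureSet_singleton
        (μ := (ν {t}).map fun z => z ⟨t, Finset.mem_singleton_self t⟩)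
      rw [isTightMeasureSet_iff_exists_isCompact_measure_compl_le] at h1
      obtain ⟨K, hKc, hK⟩ := h1 (w t) (hw0 t)
      -- With `e` in every `K t`, the coordinates outside `T` never leave the compact box, and the
      -- union bound runs over `T` only.
      refine ⟨insert e K, hKc.insert e, Set.mem_insert _ _, ?_⟩
      refine le_trans ?_ (hK _ rfl)
      rw [Measure.map_apply hm hKc.isClosed.measurableSet.compl]
      exact measure_mono fun z hz hz' => hz (Set.mem_insert_of_mem _ hz')
    choose K hKc hKe hKw using hK
    refine ⟨Set.pi Set.univ K, isCompact_univ_pi hKc, ?_⟩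
    rintro _ ⟨_, ⟨T, rfl⟩, rfl⟩
    have hcl : ∀ t, MeasurableSet (K t)ᶜ := fun t => (hKc t).isClosed.measurableSet.compl
    change (ν T).map (constExt e T) (Set.pi Set.univ K)ᶜ ≤ ε
    rw [Measure.map_apply (hem T)
      (isCompact_univ_pi hKc).isClosed.measurableSet.compl]
    have hsub : constExt e T ⁻¹' (Set.pi Set.univ K)ᶜ ⊆
        ⋃ t : T, {z : T → E | z t ∈ (K t)ᶜ} := by
      intro z hz
      simp only [Set.mem_preimage, Set.mem_compl_iff, Set.mem_pi, Set.mem_univ, true_imp_iff,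
        not_forall] at hz
      obtain ⟨t, ht⟩ := hz
      by_cases h : t ∈ T
      · rw [constExt_of_mem e z h] at ht
        exact Set.mem_iUnion.2 ⟨⟨t, h⟩, ht⟩
      · exact absurd (by simpa [constExt, h] using hKe t) ht
    calc ν T (constExt e T ⁻¹' (Set.pi Set.univ K)ᶜ)
        ≤ ν T (⋃ t : T, {z : T → E | z t ∈ (K t)ᶜ}) := measure_mono hsub
      _ ≤ ∑' t : T, ν T {z : T → E | z t ∈ (K t)ᶜ} := measure_iUnion_le _
      _ ≤ ∑' t : T, w t := by
          refine ENNReal.tsum_le_tsum fun t => ?_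
          rw [hmarg T t t.2 _ (hcl t)]
          exact hKw t
      _ ≤ ∑' t, w t := ENNReal.tsum_comp_le_tsum_of_injective Subtype.val_injective _
      _ ≤ ε := hws.le
  have hcomp := isCompact_closure_of_isTightMeasureSet htight
  -- An ultrafilter finer than `atTop` converges in the compact closure, without extraction of a
  -- subsequence.
  let U : Ultrafilter (Finset ι) := Ultrafilter.of atTop
  have hU : (U : Filter (Finset ι)) ≤ atTop := Ultrafilter.of_le _
  obtain ⟨Q, -, hQ⟩ := hcomp.ultrafilter_le_nhds' (U.map π)
    (Ultrafilter.mem_map.2 (univ_mem' fun T => subset_closure (Set.mem_range_self T)))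
  have hQ' : Tendsto π U (𝓝 Q) := hQ
  rw [ProbabilityMeasure.tendsto_iff_forall_integral_tendsto] at hQ'
  refine ⟨Q, fun I => ?_⟩
  have hIm : Measurable (I.restrict : (ι → E) → (I → E)) := Finset.measurable_restrict I
  have hQp : IsProbabilityMeasure ((Q : Measure (ι → E)).map I.restrict) :=
    Measure.isProbabilityMeasure_map hIm.aemeasurable
  let _ := TopologicalSpace.upgradeIsCompletelyMetrizable E
  refine ext_of_forall_integral_eq_of_IsFiniteMeasure fun f => ?_
  have hIc : Continuous (I.restrict : (ι → E) → (I → E)) :=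
    Finset.continuous_restrict I
  rw [integral_map hIm.aemeasurable f.continuous.measurable.aestronglyMeasurable]
  refine tendsto_nhds_unique (hQ' (f.compContinuous ⟨I.restrict, hIc⟩)) ?_
  refine tendsto_const_nhds.congr' ?_
  filter_upwards [hU (eventually_ge_atTop I)] with T hT
  have hT' : I ⊆ T := hT
  have hfc : Continuous fun x : ι → E => f (I.restrict x) := f.continuous.comp hIc
  have h1 : ∫ x, f (I.restrict x) ∂((ν T).map (constExt e T)) =
      ∫ z, f (I.restrict (constExt e T z)) ∂(ν T) :=
    integral_map (hem T).aemeasurable hfc.measurable.aestronglyMeasurable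
  have h2 : ∫ z, f z ∂((ν T).map (Finset.restrict₂ (π := fun _ => E) hT')) =
      ∫ z, f (Finset.restrict₂ (π := fun _ => E) hT' z) ∂(ν T) :=
    integral_map (Finset.measurable_restrict₂ (X := fun _ => E) hT').aemeasurable
      f.continuous.measurable.aestronglyMeasurable
  change _ = ∫ x, f (I.restrict x) ∂((ν T).map (constExt e T))
  rw [h1, hν T I hT']
  refine h2.trans (integral_congr_ae (ae_of_all _ fun z => congrArg f (funext fun t => ?_)))
  exact (constExt_of_mem e z (hT' t.2)).symm

/-- Finite measures on a product are equal if they have the same integrals of bounded continuous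
functions of finitely many coordinates, containing a given finite set. -/
theorem ext_of_forall_integral_restrict_eq {ι E : Type*} [Countable ι] [TopologicalSpace E]
    [PolishSpace E] [MeasurableSpace E] [BorelSpace E] {Q Q' : Measure (ι → E)}
    [IsFiniteMeasure Q] [IsFiniteMeasure Q'] (S : Finset ι)
    (h : ∀ T : Finset ι, S ⊆ T → ∀ f : (T → E) →ᵇ ℝ,
      ∫ x, f (T.restrict x) ∂Q = ∫ x, f (T.restrict x) ∂Q') : Q = Q' := by
  classical
  have hm : ∀ I : Finset ι, Measurable (I.restrict : (ι → E) → (I → E)) :=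
    Finset.measurable_restrict
  refine IsProjectiveLimit.unique (P := fun I => Q'.map I.restrict) (fun I => ?_) fun I => rfl
  let _ := TopologicalSpace.upgradeIsCompletelyMetrizable E
  refine ext_of_forall_integral_eq_of_IsFiniteMeasure fun f => ?_
  rw [integral_map (hm I).aemeasurable f.continuous.measurable.aestronglyMeasurable,
    integral_map (hm I).aemeasurable f.continuous.measurable.aestronglyMeasurable]
  have hsub : I ⊆ I ∪ S := Finset.subset_union_left
  have hc : Continuous (Finset.restrict₂ (π := fun _ => E) hsub) :=
    Finset.continuous_restrict₂ hsub
  exact h (I ∪ S) Finset.subset_union_right (f.compContinuous ⟨_, hc⟩)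

/-! ### Truncated moduli -/

section Modulus

variable {k d : ℕ} {ρ : FieldPath k d → ℝ≥0∞}

theorem truncModulus_nonneg (ρ : FieldPath k d → ℝ≥0∞) (Υ : Finset (Idx k)) (x : FieldPath k d) :
    0 ≤ truncModulus ρ Υ x := ENNReal.toReal_nonneg

theorem TailField.IsModulus.continuous_truncModulus (hρ : IsModulus ρ) (Υ : Finset (Idx k)) :
    Continuous (truncModulus ρ Υ) :=
  ENNReal.continuousOn_toReal.comp_continuous (hρ.continuous Υ) fun x => hρ.finite Υ x

theorem TailField.IsModulus.measurable_truncModulus (hρ : IsModulus ρ) (Υ : Finset (Idx k)) :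
    Measurable (truncModulus ρ Υ) :=
  (hρ.continuous_truncModulus Υ).measurable

theorem truncModulus_congr (ρ : FieldPath k d → ℝ≥0∞) {Υ : Finset (Idx k)} {x y : FieldPath k d}
    (h : ∀ t ∈ Υ, x t = y t) : truncModulus ρ Υ x = truncModulus ρ Υ y := by
  have : trunc Υ x = trunc Υ y := by
    funext t
    by_cases ht : t ∈ Υ
    · simp [trunc, Set.indicator, ht, h t ht]
    · simp [trunc, Set.indicator, ht]
  rw [truncModulus, truncModulus, this]

theorem TailField.IsModulus.truncModulus_smul (hρ : IsModulus ρ) (Υ : Finset (Idx k)) {c : ℝ}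
    (hc : 0 ≤ c) (x : FieldPath k d) :
    truncModulus ρ Υ (fun t => c • x t) = c * truncModulus ρ Υ x := by
  have h := hρ.homogeneous ⟨c, hc⟩ (trunc Υ x)
  have h2 : trunc Υ (fun t => c • x t) = fun t => ((⟨c, hc⟩ : ℝ≥0) : ℝ) • trunc Υ x t := by
    funext t
    by_cases ht : t ∈ Υ
    · simp [trunc, Set.indicator, ht]
    · simp [trunc, Set.indicator, ht]
  rw [truncModulus, truncModulus, h2]
  refine (congrArg ENNReal.toReal h).trans ?_
  rw [ENNReal.toReal_mul]
  rfl

theorem TailField.IsModulus.eq_zero_of_truncModulus_eq_zero (hρ : IsModulus ρ)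
    {Υ : Finset (Idx k)} {x : FieldPath k d} (h : truncModulus ρ Υ x = 0) : ∀ t ∈ Υ, x t = 0 := by
  intro t ht
  have h0 : ρ (trunc Υ x) = 0 := by
    rcases (ENNReal.toReal_eq_zero_iff _).1 h with h | h
    · exact h
    · exact absurd h (hρ.finite Υ x)
  have h1 := congrFun (hρ.definite Υ x h0) t
  simpa [trunc, Set.indicator, ht] using h1

theorem TailField.IsTranslationInvariant.truncModulus_translate (hinv : IsTranslationInvariant ρ)
    (Υ : Finset (Idx k)) (s : Idx k) (x : FieldPath k d) :
    truncModulus ρ (translate Υ s) x = truncModulus ρ Υ fun t => x (t + s) := by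
  have h : trunc (translate Υ s) x = fun t => trunc Υ (fun t => x (t + s)) (t - s) := by
    funext t
    have hiff : t ∈ translate Υ s ↔ t - s ∈ Υ := by
      simp only [translate, Finset.mem_image]
      constructor
      · rintro ⟨u, hu, rfl⟩
        simpa using hu
      · exact fun h => ⟨t - s, h, by simp⟩
    by_cases ht : t - s ∈ Υ
    · simp [trunc, Set.indicator, hiff, ht]
    · simp [trunc, Set.indicator, hiff, ht]
  rw [truncModulus, truncModulus, h, hinv s]

/-- A modulus dominates every coordinate of its index set. -/
theorem TailField.IsModulus.exists_mul_norm_le (hρ : IsModulus ρ) (Υ : Finset (Idx k)) :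
    ∃ δ : ℝ, 0 < δ ∧ ∀ x : FieldPath k d, ∀ t ∈ Υ, δ * ‖x t‖ ≤ truncModulus ρ Υ x := by
  have hcomp : IsCompact (Metric.sphere (0 : Υ → Val d) 1) := isCompact_sphere _ _
  have hcont : Continuous fun w : Υ → Val d => truncModulus ρ Υ (constExt 0 Υ w) :=
    (hρ.continuous_truncModulus Υ).comp (continuous_constExt 0 Υ)
  -- A positive lower bound on the unit sphere, by compactness and definiteness; homogeneity extends
  -- it to all of `(ℝ^d)^Υ`. An empty sphere is covered too.
  obtain ⟨δ, hδ, h⟩ := hcomp.exists_forall_le' (a := 0) hcont.continuousOn fun w hw => by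
    refine lt_of_le_of_ne (truncModulus_nonneg _ _ _) fun h0 => ?_
    have hz := hρ.eq_zero_of_truncModulus_eq_zero h0.symm
    have : w = 0 := by
      funext t
      have := hz t t.2
      rwa [constExt_of_mem 0 w t.2] at this
    rw [mem_sphere_zero_iff_norm, this, norm_zero] at hw
    exact zero_ne_one hw
  refine ⟨δ, hδ, fun x t ht => ?_⟩
  have hle : ‖x t‖ ≤ ‖Υ.restrict x‖ := norm_le_pi_norm (Υ.restrict x) ⟨t, ht⟩
  rcases (norm_nonneg (Υ.restrict x)).eq_or_lt with h0 | hpos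
  · have : ‖x t‖ = 0 := le_antisymm (by rw [h0]; exact hle) (norm_nonneg _)
    rw [this, mul_zero]
    exact truncModulus_nonneg _ _ _
  · have h1 := h (‖Υ.restrict x‖⁻¹ • Υ.restrict x) (by
      rw [mem_sphere_zero_iff_norm, norm_smul, norm_inv, norm_norm, inv_mul_cancel₀ hpos.ne'])
    have h2 : truncModulus ρ Υ (constExt 0 Υ (‖Υ.restrict x‖⁻¹ • Υ.restrict x)) =
        ‖Υ.restrict x‖⁻¹ * truncModulus ρ Υ x := by
      rw [← hρ.truncModulus_smul Υ (inv_nonneg.2 hpos.le)]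
      refine truncModulus_congr ρ fun t ht => ?_
      rw [constExt_of_mem _ _ ht]
      rfl
    rw [h2, inv_mul_eq_div, le_div_iff₀ hpos] at h1
    exact (mul_le_mul_of_nonneg_left hle hδ.le).trans h1

end Modulus

/-! ### Limit laws conditional on an exceedance -/

theorem integral_cond_eq_div {Ω : Type*} [MeasurableSpace Ω] {P : Measure Ω} {A : Set Ω}
    (f : Ω → ℝ) : ∫ ω, f ω ∂P[|A] = (∫ ω in A, f ω ∂P) / P.real A := by
  rw [ProbabilityTheory.cond, integral_smul_measure, ENNReal.toReal_inv, smul_eq_mul,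
    div_eq_inv_mul]
  rfl

section Limit

variable {k d : ℕ} {Ω : Type*} [MeasurableSpace Ω] {P : Measure Ω} [IsProbabilityMeasure P]
  {X : Idx k → Ω → Val d} {α : ℝ} {ρ : FieldPath k d → ℝ≥0∞} {Υ : Finset (Idx k)}

theorem measurableSet_exceedance (hXm : ∀ t, Measurable (X t)) (hρ : IsModulus ρ)
    (Υ : Finset (Idx k)) (x : ℝ) : MeasurableSet (exceedance X ρ Υ x) :=
  measurableSet_lt measurable_const
    ((hρ.measurable_truncModulus Υ).comp (measurable_pi_lambda _ hXm))

/-- The tail of the modulus is not lighter than the tail of the norm. -/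
theorem exists_mul_tail_le_exceedance (hX : IsRegularlyVaryingField P X α)
    (hXc : HasComparableTails P X) (hρ : IsModulus ρ) (hΥ : Υ.Nonempty) {T : Finset (Idx k)}
    (hT : Υ ⊆ T) : ∃ c : ℝ, 0 < c ∧ ∀ᶠ x : ℝ in atTop,
      c * P.real {ω | x < ‖fun t : T => X t ω‖} ≤ P.real (exceedance X ρ Υ x) := by
  obtain ⟨t₀, ht₀⟩ := hΥ
  obtain ⟨δ, hδ, hle⟩ := hρ.exists_mul_norm_le Υ
  have hO : (fun x : ℝ => P.real {ω | x < ‖fun t : T => X t ω‖}) =O[atTop]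
      fun x : ℝ => P.real {ω | x < ‖X t₀ ω‖} := by
    have h1 : (fun x : ℝ => ∑ t : T, P.real {ω | x < ‖X t ω‖}) =O[atTop]
        fun x : ℝ => P.real {ω | x < ‖X t₀ ω‖} :=
      IsBigO.fun_sum fun t _ => hXc t t₀
    refine IsBigO.trans (IsBigO.of_bound 1 ?_) h1
    filter_upwards [eventually_ge_atTop 0] with x hx
    rw [Real.norm_of_nonneg measureReal_nonneg, one_mul,
      Real.norm_of_nonneg (Finset.sum_nonneg fun _ _ => measureReal_nonneg)]
    refine (measureReal_mono (s₂ := ⋃ t : T, {ω | x < ‖X t ω‖}) ?_).trans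
      (measureReal_iUnion_fintype_le _)
    intro ω hω
    by_contra hc
    simp only [Set.mem_iUnion, Set.mem_ofPred_eq, not_exists, not_lt] at hc
    exact absurd hω (not_lt.2 ((pi_norm_le_iff_of_nonneg hx).2 hc))
  obtain ⟨C, hC0, hC⟩ := hO.exists_pos
  have hC' := hC.bound
  have hdiv : Tendsto (fun x : ℝ => x * δ⁻¹) atTop atTop :=
    tendsto_id.atTop_mul_const (inv_pos.2 hδ)
  have hrat := (hX T ⟨t₀, hT ht₀⟩).1 δ⁻¹ (inv_pos.2 hδ)
  have hlim : 0 < δ⁻¹ ^ (-α) := Real.rpow_pos_of_pos (inv_pos.2 hδ) _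
  -- `ρ_Υ(X) > x` follows from `‖X t₀‖ > x / δ`. Passing to the norm of `X_T` at the level `x / δ`
  -- costs `C`, and returning to the level `x` costs a factor with limit `δ⁻¹ ^ (-α)`, halved to
  -- hold eventually.
  refine ⟨δ⁻¹ ^ (-α) / 2 / C, by positivity, ?_⟩
  filter_upwards [hdiv.eventually hC', hrat.eventually_const_lt (half_lt_self hlim)] with x h1 h2
  rw [Real.norm_of_nonneg measureReal_nonneg, Real.norm_of_nonneg measureReal_nonneg] at h1
  have hp : 0 ≤ P.real {ω | x < ‖fun t : T => X t ω‖} := measureReal_nonneg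
  have hpp : 0 < P.real {ω | x < ‖fun t : T => X t ω‖} := by
    refine lt_of_le_of_ne hp fun h => ?_
    rw [← h, div_zero] at h2
    linarith
  rw [lt_div_iff₀ hpp] at h2
  have h3 : P.real {ω | x * δ⁻¹ < ‖X t₀ ω‖} ≤ P.real (exceedance X ρ Υ x) := by
    refine measureReal_mono fun ω (hω : x * δ⁻¹ < ‖X t₀ ω‖) => ?_
    refine lt_of_lt_of_le ?_ (hle (fun t => X t ω) t₀ ht₀)
    rwa [← div_eq_mul_inv, div_lt_iff₀ hδ, mul_comm] at hω
  rw [div_mul_eq_mul_div, div_le_iff₀ hC0]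
  nlinarith

/-- As `Υ ⊆ T`, the values filled in outside `T` do not affect `ρ_Υ`, which is therefore a
continuous homogeneous functional on `(ℝ^d)^T` as in `IsRegularlyVaryingVector.exists_limit`. The
additional point is that `{ρ_Υ > 1}` is charged, which makes conditioning possible; this is where
comparable tails enter. -/
theorem exists_limit_measure (hXm : ∀ t, Measurable (X t)) (hX : IsRegularlyVaryingField P X α)
    (hXc : HasComparableTails P X) (hρ : IsModulus ρ) (hΥ : Υ.Nonempty) {T : Finset (Idx k)}
    (hT : Υ ⊆ T) : ∃ μ : Measure (T → Val d),
      (∀ u : ℝ, 0 < u → μ {w | u < truncModulus ρ Υ (constExt 0 T w)} ≠ ∞) ∧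
      μ {w | 1 < truncModulus ρ Υ (constExt 0 T w)} ≠ 0 ∧
      (∀ u : ℝ, 0 < u → (μ.restrict {w | 1 < truncModulus ρ Υ (constExt 0 T w)}).map
          (fun w => u • w) =
        ENNReal.ofReal (u ^ α) • μ.restrict {w | u < truncModulus ρ Υ (constExt 0 T w)}) ∧
      (Tendsto (fun x : ℝ => P.real (exceedance X ρ Υ x) /
        P.real {ω | x < ‖fun t : T => X t ω‖}) atTop
          (𝓝 (μ.real {w | 1 < truncModulus ρ Υ (constExt 0 T w)}))) ∧
      ∀ f : (T → Val d) →ᵇ ℝ, Tendsto (fun x : ℝ =>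
          (∫ ω in exceedance X ρ Υ x, f (fun t : T => x⁻¹ • X t ω) ∂P) /
        P.real {ω | x < ‖fun t : T => X t ω‖}) atTop
          (𝓝 (∫ w in {w | 1 < truncModulus ρ Υ (constExt 0 T w)}, f w ∂μ)) := by
  have hXT : Measurable fun ω (t : T) => X t ω := measurable_pi_lambda _ fun t => hXm t
  have hrc : Continuous fun w : T → Val d => truncModulus ρ Υ (constExt 0 T w) :=
    (hρ.continuous_truncModulus Υ).comp (continuous_constExt 0 T)
  have hrh : ∀ c : ℝ, 0 < c → ∀ w : T → Val d, truncModulus ρ Υ (constExt 0 T (c • w)) =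
      c * truncModulus ρ Υ (constExt 0 T w) := by
    intro c hc w
    rw [← hρ.truncModulus_smul Υ hc.le]
    refine truncModulus_congr ρ fun t ht => ?_
    rw [constExt_of_mem _ _ (hT ht), constExt_of_mem _ _ (hT ht)]
    rfl
  obtain ⟨μ, hfin, hhom, hconv⟩ := (hX T (hΥ.mono hT)).exists_limit hXT hrc hrh
  have hset : ∀ x : ℝ, {ω | x < truncModulus ρ Υ (constExt 0 T fun t : T => X t ω)} =
      exceedance X ρ Υ x := by
    intro x
    ext ω
    simp only [Set.mem_ofPred_eq, exceedance]
    rw [truncModulus_congr ρ (y := fun t => X t ω) fun t ht =>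
      constExt_of_mem 0 (fun t : T => X t ω) (hT ht)]
  have hconv' : ∀ f : (T → Val d) →ᵇ ℝ, Tendsto (fun x : ℝ =>
          (∫ ω in exceedance X ρ Υ x, f (fun t : T => x⁻¹ • X t ω) ∂P) /
        P.real {ω | x < ‖fun t : T => X t ω‖}) atTop
          (𝓝 (∫ w in {w | 1 < truncModulus ρ Υ (constExt 0 T w)}, f w ∂μ)) := by
    intro f
    refine (hconv f).congr fun x => ?_
    rw [hset]
    rfl
  have h1 := hconv' (BoundedContinuousFunction.const _ 1)
  simp only [BoundedContinuousFunction.const_apply, integral_const, smul_eq_mul, mul_one,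
    measureReal_restrict_apply_univ] at h1
  refine ⟨μ, hfin, fun h0 => ?_, hhom, h1, hconv'⟩
  obtain ⟨c, hc, hle⟩ := exists_mul_tail_le_exceedance hX hXc hρ hΥ hT
  have hge : c ≤ μ.real {w | 1 < truncModulus ρ Υ (constExt 0 T w)} := by
    refine ge_of_tendsto h1 ?_
    have ht := (hX T (hΥ.mono hT)).1 1 one_pos
    rw [Real.one_rpow] at ht
    filter_upwards [hle, ht.eventually_ne one_ne_zero] with x hx hx1
    rwa [le_div_iff₀]
    refine lt_of_le_of_ne measureReal_nonneg fun h => hx1 ?_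
    rw [← h, div_zero]
  rw [Measure.real, h0, ENNReal.toReal_zero] at hge
  linarith

/-- The tail of the modulus is regularly varying. -/
theorem tendsto_exceedance_ratio (hXm : ∀ t, Measurable (X t)) (hX : IsRegularlyVaryingField P X α)
    (hXc : HasComparableTails P X) (hρ : IsModulus ρ) (hΥ : Υ.Nonempty) {y : ℝ} (hy : 0 < y) :
    Tendsto (fun x : ℝ => P.real (exceedance X ρ Υ (x * y)) / P.real (exceedance X ρ Υ x))
      atTop (𝓝 (y ^ (-α))) := by
  obtain ⟨μ, hfin, hne, -, h1, -⟩ := exists_limit_measure hXm hX hXc hρ hΥ (Finset.Subset.refl Υ)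
  have hψ : μ.real {w | 1 < truncModulus ρ Υ (constExt 0 Υ w)} ≠ 0 :=
    (ENNReal.toReal_pos hne (hfin 1 one_pos)).ne'
  have hmul : Tendsto (fun x : ℝ => x * y) atTop atTop := tendsto_id.atTop_mul_const hy
  -- The exceedance probabilities at `x * y` and `x` are compared through the norm tails at these
  -- levels; the limiting masses cancel.
  have h2 := ((h1.comp hmul).mul ((hX Υ hΥ).1 y hy)).div h1 hψ
  rw [mul_comm, mul_div_cancel_right₀ _ hψ] at h2
  have ht := (hX Υ hΥ).1 1 one_pos
  rw [Real.one_rpow] at ht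
  have hp : ∀ᶠ x : ℝ in atTop, P.real {ω | x < ‖fun t : Υ => X t ω‖} ≠ 0 := by
    filter_upwards [ht.eventually_ne one_ne_zero] with x hx h0
    exact hx (by rw [h0, div_zero])
  refine h2.congr' ?_
  filter_upwards [hp, hmul.eventually hp] with x hx hxy
  simp only [Function.comp_apply, Pi.div_apply]
  rw [div_mul_div_cancel₀ hxy, div_div_div_cancel_right₀ hx]

theorem eventually_exceedance_ne_zero (hXm : ∀ t, Measurable (X t))
    (hX : IsRegularlyVaryingField P X α) (hXc : HasComparableTails P X) (hρ : IsModulus ρ)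
    (hΥ : Υ.Nonempty) : ∀ᶠ x : ℝ in atTop, P (exceedance X ρ Υ x) ≠ 0 := by
  have h := tendsto_exceedance_ratio hXm hX hXc hρ hΥ one_pos
  rw [Real.one_rpow] at h
  filter_upwards [h.eventually_ne one_ne_zero] with x hx h0
  exact hx (by simp [Measure.real, h0])

/-- The finite-dimensional limit laws of `x⁻¹ X` given an exceedance. -/
theorem exists_limit_law (hXm : ∀ t, Measurable (X t)) (hX : IsRegularlyVaryingField P X α)
    (hXc : HasComparableTails P X) (hρ : IsModulus ρ) (hΥ : Υ.Nonempty) {T : Finset (Idx k)}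
    (hT : Υ ⊆ T) : ∃ ν : Measure (T → Val d), IsProbabilityMeasure ν ∧
      (∀ u : ℝ, 1 ≤ u → ν.restrict {w | u < truncModulus ρ Υ (constExt 0 T w)} =
        ENNReal.ofReal (u ^ (-α)) • ν.map (fun w => u • w)) ∧
      ∀ f : (T → Val d) →ᵇ ℝ, Tendsto (fun x : ℝ =>
          ∫ ω, f (fun t : T => x⁻¹ • X t ω) ∂P[|exceedance X ρ Υ x]) atTop (𝓝 (∫ w, f w ∂ν)) := by
  obtain ⟨μ, hfin, hne, hhom, h1, hconv⟩ := exists_limit_measure hXm hX hXc hρ hΥ hT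
  have hrc : Continuous fun w : T → Val d => truncModulus ρ Υ (constExt 0 T w) :=
    (hρ.continuous_truncModulus Υ).comp (continuous_constExt 0 T)
  have hA : ∀ u : ℝ, MeasurableSet {w : T → Val d | u < truncModulus ρ Υ (constExt 0 T w)} :=
    fun u => measurableSet_lt measurable_const hrc.measurable
  have hψ : μ.real {w | 1 < truncModulus ρ Υ (constExt 0 T w)} ≠ 0 :=
    (ENNReal.toReal_pos hne (hfin 1 one_pos)).ne'
  refine ⟨μ[|{w | 1 < truncModulus ρ Υ (constExt 0 T w)}], cond_isProbabilityMeasure_of_finite hne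
    (hfin 1 one_pos), fun u hu => ?_, fun f => ?_⟩
  · have hu0 : 0 < u := one_pos.trans_le hu
    have hsub : {w : T → Val d | u < truncModulus ρ Υ (constExt 0 T w)} ⊆
        {w | 1 < truncModulus ρ Υ (constExt 0 T w)} :=
      fun w (hw : u < truncModulus ρ Υ (constExt 0 T w)) => hu.trans_lt hw
    rw [ProbabilityTheory.cond, Measure.restrict_smul, Measure.restrict_restrict (hA u),
      Set.inter_eq_self_of_subset_left hsub, Measure.map_smul, hhom u hu0, smul_comm (ENNReal.ofReal (u ^ (-α))),
      smul_smul (ENNReal.ofReal (u ^ (-α))), ← ENNReal.ofReal_mul (by positivity), ← Real.rpow_add hu0]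
    simp
  · rw [ProbabilityTheory.cond, integral_smul_measure, ENNReal.toReal_inv, smul_eq_mul,
      ← div_eq_inv_mul]
    have ht := (hX T (hΥ.mono hT)).1 1 one_pos
    rw [Real.one_rpow] at ht
    refine ((hconv f).div h1 hψ).congr' ?_
    filter_upwards [ht.eventually_ne one_ne_zero] with x hx
    rw [integral_cond_eq_div, Pi.div_apply, div_div_div_cancel_right₀]
    exact fun h0 => hx (by rw [h0, div_zero])

end Limit

/-! ### Existence and scaling of the tail field -/

section TailLaw

variable {k d : ℕ} {Ω : Type*} [MeasurableSpace Ω] {P : Measure Ω}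
  {X : Idx k → Ω → Val d} {α : ℝ} {ρ : FieldPath k d → ℝ≥0∞} {Υ : Finset (Idx k)}

/-- The tail field as a measure on the path space. -/
theorem TailField.IsTailField.map {Ω' : Type*} [MeasurableSpace Ω'] {P' : Measure Ω'}
    {Y : Idx k → Ω' → Val d} (h : IsTailField P X ρ Υ P' Y) :
    IsTailField P X ρ Υ (P'.map fun ω t => Y t ω) fun t x => x t := by
  refine ⟨fun t => measurable_pi_apply t, fun T f => ?_⟩
  have hf : Measurable fun x : FieldPath k d => f fun t : T => x t :=
    f.continuous.measurable.comp (measurable_pi_lambda _ fun t => measurable_pi_apply _)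
  rw [integral_map (measurable_pi_lambda _ h.1).aemeasurable hf.aestronglyMeasurable]
  exact h.2 T f

/-- Convergence to the tail field on continuous functions of finitely many coordinates. -/
theorem TailField.IsTailField.tendsto_of_dependsOn {Ω' : Type*} [MeasurableSpace Ω']
    {P' : Measure Ω'} {Y : Idx k → Ω' → Val d} (h : IsTailField P X ρ Υ P' Y)
    {f : FieldPath k d → ℝ} (hf : Continuous f) {C : ℝ} (hC : ∀ x, |f x| ≤ C)
    {T : Finset (Idx k)} (hT : ∀ x y, (∀ t ∈ T, x t = y t) → f x = f y) :
    Tendsto (fun x : ℝ => ∫ ω, f (fun t => x⁻¹ • X t ω) ∂P[|exceedance X ρ Υ x])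
      atTop (𝓝 (∫ ω', f (fun t => Y t ω') ∂P')) := by
  have h1 := h.2 T (bcfOfBound (fun z => f (constExt 0 T z))
    (hf.comp (continuous_constExt 0 T)) fun z => hC _)
  have h2 : ∀ y : FieldPath k d, f (constExt 0 T fun t : T => y t) = f y := fun y =>
    hT _ _ fun t ht => constExt_of_mem 0 (fun t : T => y t) ht
  have h3 : (fun ω' => f (constExt 0 T fun t : T => Y t ω')) = fun ω' => f fun t => Y t ω' :=
    funext fun ω' => h2 fun t => Y t ω'
  simp only [bcfOfBound_apply] at h1
  rw [h3] at h1
  refine h1.congr fun x => ?_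
  congr 1
  funext ω
  exact h2 fun t => x⁻¹ • X t ω

/-- The normalized path `x / ρ_Υ(x)`. -/
noncomputable def normalizedPath (ρ : FieldPath k d → ℝ≥0∞) (Υ : Finset (Idx k))
    (x : FieldPath k d) : FieldPath k d :=
  fun t => (truncModulus ρ Υ x)⁻¹ • x t

theorem TailField.IsModulus.measurable_normalizedPath (hρ : IsModulus ρ) (Υ : Finset (Idx k)) :
    Measurable (normalizedPath ρ Υ) :=
  measurable_pi_lambda _ fun t =>
    (hρ.measurable_truncModulus Υ).inv.smul (measurable_pi_apply t)

theorem TailField.IsModulus.normalizedPath_smul (hρ : IsModulus ρ) (Υ : Finset (Idx k)) {c : ℝ}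
    (hc : 0 < c) (x : FieldPath k d) :
    normalizedPath ρ Υ (fun t => c • x t) = normalizedPath ρ Υ x := by
  funext t
  rw [normalizedPath, hρ.truncModulus_smul Υ hc.le, smul_smul, mul_inv, mul_right_comm,
    inv_mul_cancel₀ hc.ne', one_mul]
  rfl

variable [IsProbabilityMeasure P]

/-- The limit laws are at hand only for index sets containing `Υ`, on which the conditioning event
can be read off. For general `T` the law on `T ∪ Υ` is projected, and uniqueness of limits makes the
projections consistent. -/
theorem exists_tailField (hXm : ∀ t, Measurable (X t)) (hX : IsRegularlyVaryingField P X α)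
    (hXc : HasComparableTails P X) (hρ : IsModulus ρ) (hΥ : Υ.Nonempty) :
    ∃ Q : Measure (FieldPath k d), IsProbabilityMeasure Q ∧
      IsTailField P X ρ Υ Q fun t x => x t := by
  choose ν hνp _ hν using fun T : Finset (Idx k) =>
    exists_limit_law hXm hX hXc hρ hΥ (T := T ∪ Υ) Finset.subset_union_right
  have hm : ∀ {I J : Finset (Idx k)} (h : J ⊆ I),
      Measurable (Finset.restrict₂ (π := fun _ : Idx k => Val d) h) := fun h =>
    Finset.measurable_restrict₂ (X := fun _ => Val d) h
  have hc : ∀ {I J : Finset (Idx k)} (h : J ⊆ I),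
      Continuous (Finset.restrict₂ (π := fun _ : Idx k => Val d) h) := fun h =>
    Finset.continuous_restrict₂ h
  let ν' : ∀ T : Finset (Idx k), Measure (T → Val d) := fun T =>
    (ν T).map (Finset.restrict₂ (π := fun _ : Idx k => Val d) Finset.subset_union_left)
  have hp : ∀ T, IsProbabilityMeasure (ν' T) := fun T =>
    Measure.isProbabilityMeasure_map (hm _).aemeasurable
  have hlim : ∀ (T : Finset (Idx k)) (f : (T → Val d) →ᵇ ℝ), Tendsto (fun x : ℝ =>
      ∫ ω, f (fun t : T => x⁻¹ • X t ω) ∂P[|exceedance X ρ Υ x]) atTop (𝓝 (∫ w, f w ∂(ν' T))) := by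
    intro T f
    have := hν T (f.compContinuous ⟨_, hc Finset.subset_union_left⟩)
    rw [integral_map (hm _).aemeasurable f.continuous.measurable.aestronglyMeasurable]
    exact this
  obtain ⟨Q, hQ⟩ := exists_isProjectiveLimit ν' fun I J hJI => by
    have hpI : IsProbabilityMeasure
        ((ν' I).map (Finset.restrict₂ (π := fun _ : Idx k => Val d) hJI)) :=
      Measure.isProbabilityMeasure_map (hm _).aemeasurable
    refine ext_of_forall_integral_eq_of_IsFiniteMeasure fun f => ?_
    refine tendsto_nhds_unique (hlim J f) ?_
    have h1 := hlim I (f.compContinuous ⟨_, hc hJI⟩)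
    have h2 : ∫ z, f z ∂((ν' I).map (Finset.restrict₂ (π := fun _ : Idx k => Val d) hJI)) =
        ∫ z, f (Finset.restrict₂ (π := fun _ : Idx k => Val d) hJI z) ∂(ν' I) :=
      integral_map (hm _).aemeasurable f.continuous.measurable.aestronglyMeasurable
    rw [h2]
    exact h1
  refine ⟨Q, hQ.isProbabilityMeasure, fun t => measurable_pi_apply t, fun T f => ?_⟩
  have h1 := hlim T f
  rw [← hQ T] at h1
  have h2 : ∫ z, f z ∂(Q.map T.restrict) = ∫ x, f (T.restrict x) ∂Q :=
    integral_map (Finset.measurable_restrict (X := fun _ => Val d) T).aemeasurable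
      f.continuous.measurable.aestronglyMeasurable
  rw [h2] at h1
  exact h1

variable {Q : Measure (FieldPath k d)} [IsProbabilityMeasure Q]

/-- Scaling property of the law of a tail field. -/
theorem TailField.IsTailField.restrict_eq (hXm : ∀ t, Measurable (X t))
    (hX : IsRegularlyVaryingField P X α) (hXc : HasComparableTails P X) (hρ : IsModulus ρ)
    (hΥ : Υ.Nonempty) (hQ : IsTailField P X ρ Υ Q fun t x => x t) {u : ℝ} (hu : 1 ≤ u) :
    Q.restrict {x | u < truncModulus ρ Υ x} =
      ENNReal.ofReal (u ^ (-α)) • Q.map fun x t => u • x t := by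
  have hA : MeasurableSet {x | u < truncModulus ρ Υ x} :=
    measurableSet_lt measurable_const (hρ.measurable_truncModulus Υ)
  have hsm : Measurable fun (x : FieldPath k d) t => u • x t :=
    measurable_pi_lambda _ fun t => (measurable_pi_apply t).const_smul u
  have i1 : IsFiniteMeasure (ENNReal.ofReal (u ^ (-α)) •
      Q.map fun (x : FieldPath k d) t => u • x t) := Measure.smul_finite _ ENNReal.ofReal_ne_top
  -- Only `T ⊇ Υ` need be tested; there the event is a function of the coordinates in `T`, and the
  -- marginal of `Q` is the limit law `ν` with its scaling property.
  refine ext_of_forall_integral_restrict_eq Υ fun T hT f => ?_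
  obtain ⟨ν, hνp, hνs, hν⟩ := exists_limit_law hXm hX hXc hρ hΥ hT
  have hr : Measurable (T.restrict : FieldPath k d → (T → Val d)) :=
    Finset.measurable_restrict (X := fun _ => Val d) T
  have i2 : IsProbabilityMeasure (Q.map T.restrict) :=
    Measure.isProbabilityMeasure_map hr.aemeasurable
  have hfm : ∀ m : Measure (T → Val d), AEStronglyMeasurable f m := fun m =>
    f.continuous.measurable.aestronglyMeasurable
  have hlaw : Q.map T.restrict = ν := by
    refine ext_of_forall_integral_eq_of_IsFiniteMeasure fun f => ?_
    rw [integral_map hr.aemeasurable f.continuous.measurable.aestronglyMeasurable]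
    exact tendsto_nhds_unique (hQ.2 T f) (hν f)
  have hset : {x : FieldPath k d | u < truncModulus ρ Υ x} =
      T.restrict ⁻¹' {w | u < truncModulus ρ Υ (constExt 0 T w)} := by
    ext x
    simp only [Set.mem_ofPred_eq, Set.mem_preimage]
    rw [truncModulus_congr ρ (y := x) fun t ht => constExt_of_mem 0 (T.restrict x) (hT ht)]
  have hA' : MeasurableSet {w : T → Val d | u < truncModulus ρ Υ (constExt 0 T w)} :=
    measurableSet_lt measurable_const ((hρ.measurable_truncModulus Υ).comp
      (continuous_constExt 0 T).measurable)
  have hus : Measurable fun w : T → Val d => u • w := measurable_id.const_smul u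
  have e1 : ∫ x in {x | u < truncModulus ρ Υ x}, f (T.restrict x) ∂Q =
      ∫ w in {w | u < truncModulus ρ Υ (constExt 0 T w)}, f w ∂ν := by
    rw [← hlaw, setIntegral_map hA' (hfm _) hr.aemeasurable, ← hset]
  rw [e1, hνs u hu, integral_smul_measure, integral_smul_measure,
    integral_map hus.aemeasurable (hfm _), ← hlaw]
  have e2 : ∫ w, f (u • w) ∂(Q.map T.restrict) = ∫ x, f (u • T.restrict x) ∂Q :=
    integral_map hr.aemeasurable (f.continuous.measurable.comp hus).aestronglyMeasurable
  have e3 : ∫ x, f (T.restrict x) ∂(Q.map fun (x : FieldPath k d) t => u • x t) =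
      ∫ x, f (T.restrict fun t => u • x t) ∂Q :=
    integral_map hsm.aemeasurable (f.continuous.measurable.comp hr).aestronglyMeasurable
  rw [e2, e3]
  rfl

/-- Used with `E` the whole space (Pareto law), a scale invariant event (independence), and a level
set of a modulus (absence of atoms). -/
theorem TailField.IsTailField.measure_lt (hXm : ∀ t, Measurable (X t))
    (hX : IsRegularlyVaryingField P X α) (hXc : HasComparableTails P X) (hρ : IsModulus ρ)
    (hΥ : Υ.Nonempty) (hQ : IsTailField P X ρ Υ Q fun t x => x t) {u : ℝ} (hu : 1 ≤ u)
    {E : Set (FieldPath k d)} (hE : MeasurableSet E) :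
    Q (E ∩ {x | u < truncModulus ρ Υ x}) =
      ENNReal.ofReal (u ^ (-α)) * Q {x | (fun t => u • x t) ∈ E} := by
  have hsm : Measurable fun (x : FieldPath k d) t => u • x t :=
    measurable_pi_lambda _ fun t => (measurable_pi_apply t).const_smul u
  have := congrArg (fun m : Measure (FieldPath k d) => m E)
    (hQ.restrict_eq hXm hX hXc hρ hΥ hu)
  simp only [Measure.smul_apply, smul_eq_mul] at this
  rw [Measure.restrict_apply hE, Measure.map_apply hsm hE] at this
  exact this

/-- The modulus of a tail field has a Pareto law. -/
theorem TailField.IsTailField.measure_modulus (hXm : ∀ t, Measurable (X t))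
    (hX : IsRegularlyVaryingField P X α) (hXc : HasComparableTails P X) (hρ : IsModulus ρ)
    (hΥ : Υ.Nonempty) (hQ : IsTailField P X ρ Υ Q fun t x => x t) {u : ℝ} (hu : 1 ≤ u) :
    Q {x | u < truncModulus ρ Υ x} = ENNReal.ofReal (u ^ (-α)) := by
  have := hQ.measure_lt hXm hX hXc hρ hΥ hu MeasurableSet.univ
  simpa using this

theorem TailField.IsTailField.ae_one_lt (hXm : ∀ t, Measurable (X t))
    (hX : IsRegularlyVaryingField P X α) (hXc : HasComparableTails P X) (hρ : IsModulus ρ)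
    (hΥ : Υ.Nonempty) (hQ : IsTailField P X ρ Υ Q fun t x => x t) :
    ∀ᵐ x ∂Q, 1 < truncModulus ρ Υ x := by
  have h := hQ.measure_modulus hXm hX hXc hρ hΥ le_rfl
  rw [Real.one_rpow, ENNReal.ofReal_one] at h
  exact (prob_compl_eq_zero_iff (measurableSet_lt measurable_const
    (hρ.measurable_truncModulus Υ))).2 h

/-- The normalized tail field is a spectral field. -/
theorem TailField.IsTailField.isSpectralField (hXm : ∀ t, Measurable (X t))
    (hX : IsRegularlyVaryingField P X α) (hXc : HasComparableTails P X) (hρ : IsModulus ρ)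
    (hΥ : Υ.Nonempty) {Ω' : Type*} [MeasurableSpace Ω'] {P' : Measure Ω'} [IsProbabilityMeasure P']
    {Y : Idx k → Ω' → Val d} (hY : IsTailField P X ρ Υ P' Y) :
    IsSpectralField P X ρ Υ P' (normalized Y ρ Υ) := by
  have hYm : Measurable fun ω t => Y t ω := measurable_pi_lambda _ hY.1
  refine ⟨fun t => ((hρ.measurable_truncModulus Υ).comp hYm).inv.smul (hY.1 t), fun T f => ?_⟩
  -- Division by `ρ_Υ` is discontinuous at its zeros. Division by `max 1 ρ_Υ` is continuous and
  -- agrees with it where `ρ_Υ ≥ 1`: almost surely for `Y`, and for `x⁻¹ X` on the exceedance event.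
  have hc : Continuous fun (x : FieldPath k d) (t : T) =>
      (max 1 (truncModulus ρ Υ x))⁻¹ • x t := by
    refine continuous_pi fun t => ?_
    have hproj : Continuous fun x : FieldPath k d => x t := continuous_apply (t : Idx k)
    have hinv : Continuous fun x : FieldPath k d => (max 1 (truncModulus ρ Υ x))⁻¹ :=
      (continuous_const.max (hρ.continuous_truncModulus Υ)).inv₀ fun x =>
        (one_pos.trans_le (le_max_left _ _)).ne'
    exact hinv.smul hproj
  have h1 := hY.tendsto_of_dependsOn (f := fun x => f fun t : T =>
    (max 1 (truncModulus ρ Υ x))⁻¹ • x t) (f.continuous.comp hc)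
    (fun x => f.norm_coe_le_norm _) (T := T ∪ Υ) fun x y hxy => by
      rw [truncModulus_congr ρ fun t ht => hxy t (Finset.mem_union_right _ ht)]
      refine congrArg f (funext fun t => ?_)
      rw [hxy t (Finset.mem_union_left _ t.2)]
  have hQp : IsProbabilityMeasure (P'.map fun ω t => Y t ω) :=
    Measure.isProbabilityMeasure_map hYm.aemeasurable
  have hae := ae_of_ae_map hYm.aemeasurable (hY.map.ae_one_lt hXm hX hXc hρ hΥ)
  have h2 : ∫ ω', f (fun t : T => normalized Y ρ Υ t ω') ∂P' = ∫ ω', f (fun t : T =>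
      (max 1 (truncModulus ρ Υ fun t => Y t ω'))⁻¹ • Y t ω') ∂P' := by
    refine integral_congr_ae ?_
    filter_upwards [hae] with ω hω
    rw [max_eq_right hω.le]
    rfl
  rw [h2]
  refine h1.congr' ?_
  filter_upwards [eventually_gt_atTop 0] with x hx
  rw [integral_cond_eq_div, integral_cond_eq_div]
  congr 1
  refine setIntegral_congr_fun (measurableSet_exceedance hXm hρ Υ x) fun ω hω => ?_
  have hω' : x < truncModulus ρ Υ fun t => X t ω := hω
  have hsc := hρ.truncModulus_smul Υ (inv_nonneg.2 hx.le) fun t => X t ω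
  have hone : 1 ≤ x⁻¹ * truncModulus ρ Υ fun t => X t ω := by
    rw [inv_mul_eq_div, one_le_div hx]
    exact hω'.le
  refine congrArg f (funext fun t => ?_)
  rw [hsc, max_eq_right hone, smul_smul, mul_inv, inv_inv, mul_right_comm, mul_inv_cancel₀ hx.ne',
    one_mul]
  rfl

/-- The modulus of a tail field does not charge levels. -/
theorem TailField.IsTailField.measure_level_eq_zero (hXm : ∀ t, Measurable (X t))
    (hX : IsRegularlyVaryingField P X α) (hXc : HasComparableTails P X) (hρ : IsModulus ρ)
    (hΥ : Υ.Nonempty) (hQ : IsTailField P X ρ Υ Q fun t x => x t) (S : Finset (Idx k)) {c : ℝ}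
    (hc : 0 < c) : Q {x | truncModulus ρ S x = c} = 0 := by
  by_contra hne
  have hcount := Measure.countable_meas_level_set_pos (μ := Q) (hρ.measurable_truncModulus S)
  -- By scaling, an atom at `c` would produce an atom at every `t ≥ c`, whereas a finite measure
  -- charges only countably many levels.
  have hsub : Set.Ici c ⊆ {t : ℝ | 0 < Q {x | truncModulus ρ S x = t}} := by
    intro t ht
    have ht' : 1 ≤ t / c := (one_le_div hc).2 ht
    have hE : MeasurableSet {x | truncModulus ρ S x = t} :=
      hρ.measurable_truncModulus S (measurableSet_singleton t)
    have h := hQ.measure_lt hXm hX hXc hρ hΥ ht' hE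
    have hset : {x : FieldPath k d | (fun u => (t / c) • x u) ∈ {x | truncModulus ρ S x = t}} =
        {x | truncModulus ρ S x = c} := by
      ext x
      simp only [Set.mem_ofPred_eq]
      have ht0 : 0 < t / c := one_pos.trans_le ht'
      have ht1 : t ≠ 0 := (hc.trans_le ht).ne'
      rw [hρ.truncModulus_smul S ht0.le]
      constructor
      · intro h
        field_simp at h
        exact h
      · intro h
        rw [h]
        field_simp
    rw [hset] at h
    refine lt_of_lt_of_le (pos_iff_ne_zero.2 ?_)
      (measure_mono (Set.inter_subset_left (t := {x | t / c < truncModulus ρ Υ x})))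
    rw [h]
    refine mul_ne_zero ?_ hne
    rw [Ne, ENNReal.ofReal_eq_zero, not_le]
    exact Real.rpow_pos_of_pos (one_pos.trans_le ht') _
  have h0 := (hcount.mono hsub).measure_zero (volume : Measure ℝ)
  simp at h0

end TailLaw

/-! ### The measure `d(-r^(-α))` -/

section PowerMeasure

variable {α : ℝ}

instance (α : ℝ) : SigmaFinite (powerMeasure α) := by
  unfold powerMeasure
  exact SigmaFinite.withDensity_ofReal _

theorem powerMeasure_Ioi (hα : 0 < α) {u : ℝ} (hu : 0 < u) :
    powerMeasure α (Set.Ioi u) = ENNReal.ofReal (u ^ (-α)) := by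
  rw [powerMeasure, withDensity_apply _ measurableSet_Ioi,
    Measure.restrict_restrict measurableSet_Ioi,
    Set.inter_eq_self_of_subset_left (Set.Ioi_subset_Ioi hu.le),
    ← ofReal_integral_eq_lintegral_ofReal]
  · rw [integral_const_mul, integral_Ioi_rpow_of_lt (by linarith) hu]
    congr 1
    rw [sub_add_cancel]
    field_simp
  · exact (integrableOn_Ioi_rpow_of_lt (by linarith) hu).const_mul α
  · rw [EventuallyLE, ae_restrict_iff' measurableSet_Ioi]
    exact ae_of_all _ fun r hr => mul_nonneg hα.le (Real.rpow_nonneg (hu.trans hr).le _)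

theorem powerMeasure_Iic_zero (α : ℝ) : powerMeasure α (Set.Iic 0) = 0 := by
  rw [powerMeasure, withDensity_apply _ measurableSet_Iic,
    Measure.restrict_restrict measurableSet_Iic, Set.inter_comm, Set.Ioi_inter_Iic, Set.Ioc_self,
    Measure.restrict_empty, lintegral_zero_measure]

theorem ae_powerMeasure_pos (α : ℝ) : ∀ᵐ r ∂powerMeasure α, 0 < r := by
  rw [ae_iff]
  have : {r : ℝ | ¬0 < r} = Set.Iic 0 := by
    ext r
    simp
  rw [this, powerMeasure_Iic_zero]

theorem MeasureTheory.Measure.ext_of_Ioi {μ ν : Measure ℝ} [IsFiniteMeasure μ] [IsFiniteMeasure ν]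
    (h : ∀ a, μ (Set.Ioi a) = ν (Set.Ioi a)) (huniv : μ Set.univ = ν Set.univ) : μ = ν := by
  refine Measure.ext_of_Iic μ ν fun a => ?_
  rw [← Set.compl_Ioi, measure_compl measurableSet_Ioi (measure_ne_top _ _),
    measure_compl measurableSet_Ioi (measure_ne_top _ _), h, huniv]

theorem isFiniteMeasure_powerMeasure_restrict (hα : 0 < α) {u : ℝ} (hu : 0 < u) :
    IsFiniteMeasure ((powerMeasure α).restrict (Set.Ioi u)) :=
  isFiniteMeasure_restrict.2 (by rw [powerMeasure_Ioi hα hu]; exact ENNReal.ofReal_ne_top)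

/-- Scaling of the power measure. -/
theorem map_mul_powerMeasure_restrict (hα : 0 < α) {c : ℝ} (hc : 0 < c) :
    ((powerMeasure α).restrict (Set.Ioi 1)).map (fun r => c * r) =
      ENNReal.ofReal (c ^ α) • (powerMeasure α).restrict (Set.Ioi c) := by
  have i1 := isFiniteMeasure_powerMeasure_restrict hα one_pos
  have i2 := isFiniteMeasure_powerMeasure_restrict hα hc
  have i3 : IsFiniteMeasure (ENNReal.ofReal (c ^ α) • (powerMeasure α).restrict (Set.Ioi c)) :=
    Measure.smul_finite _ ENNReal.ofReal_ne_top
  have hm : Measurable fun r : ℝ => c * r := measurable_const_mul c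
  refine Measure.ext_of_Ioi (fun a => ?_) ?_
  · have hpre : (fun r => c * r) ⁻¹' Set.Ioi a = Set.Ioi (a / c) := by
      ext r
      simp only [Set.mem_preimage, Set.mem_Ioi]
      rw [div_lt_iff₀ hc, mul_comm]
    have hpos : 0 < max (a / c) 1 := one_pos.trans_le (le_max_right _ _)
    have hpos' : 0 < max a c := hc.trans_le (le_max_right _ _)
    rw [Measure.map_apply hm measurableSet_Ioi, hpre, Measure.smul_apply, smul_eq_mul,
      Measure.restrict_apply measurableSet_Ioi, Measure.restrict_apply measurableSet_Ioi,
      Set.Ioi_inter_Ioi, Set.Ioi_inter_Ioi, powerMeasure_Ioi hα hpos, powerMeasure_Ioi hα hpos',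
      ← ENNReal.ofReal_mul (by positivity)]
    congr 1
    have : max (a / c) 1 = max a c / c := by
      rw [← max_div_div_right hc.le, div_self hc.ne']
    rw [this, Real.div_rpow hpos'.le hc.le, Real.rpow_neg hc.le, div_inv_eq_mul, mul_comm]
  · rw [Measure.map_apply hm MeasurableSet.univ, Set.preimage_univ, Measure.smul_apply,
      smul_eq_mul, Measure.restrict_apply_univ, Measure.restrict_apply_univ,
      powerMeasure_Ioi hα one_pos, powerMeasure_Ioi hα hc, ← ENNReal.ofReal_mul (by positivity),
      ← Real.rpow_add hc]
    simp

end PowerMeasure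

/-! ### Polar decomposition of the tail field -/

section Polar

variable {k d : ℕ} {Ω : Type*} [MeasurableSpace Ω] {P : Measure Ω} [IsProbabilityMeasure P]
  {X : Idx k → Ω → Val d} {α : ℝ} {ρ : FieldPath k d → ℝ≥0∞} {Υ : Finset (Idx k)}
  {Q : Measure (FieldPath k d)} [IsProbabilityMeasure Q]

/-- Polar decomposition of a tail field: the modulus is Pareto and independent of the
normalized field. -/
theorem TailField.IsTailField.map_polar (hXm : ∀ t, Measurable (X t)) (hα : 0 < α)
    (hX : IsRegularlyVaryingField P X α) (hXc : HasComparableTails P X) (hρ : IsModulus ρ)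
    (hΥ : Υ.Nonempty) (hQ : IsTailField P X ρ Υ Q fun t x => x t) :
    Q.map (fun x => (truncModulus ρ Υ x, normalizedPath ρ Υ x)) =
      ((powerMeasure α).restrict (Set.Ioi 1)).prod (Q.map (normalizedPath ρ Υ)) := by
  have hr := hρ.measurable_truncModulus Υ
  have hN := hρ.measurable_normalizedPath Υ
  have i1 := isFiniteMeasure_powerMeasure_restrict hα one_pos
  have hae := hQ.ae_one_lt hXm hX hXc hρ hΥ
  refine (Measure.prod_eq fun s E hs hE => ?_).symm
  have hNE : MeasurableSet (normalizedPath ρ Υ ⁻¹' E) := hN hE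
  rw [Measure.map_apply (hr.prodMk hN) (hs.prod hE), Measure.map_apply hN hE]
  have i2 : IsFiniteMeasure (Q (normalizedPath ρ Υ ⁻¹' E) •
      (powerMeasure α).restrict (Set.Ioi 1)) := Measure.smul_finite _ (measure_ne_top _ _)
  -- Preimages under normalization are scale invariant, so the scaling property factorizes.
  have hlt : ∀ a : ℝ, 1 ≤ a → Q (normalizedPath ρ Υ ⁻¹' E ∩ {x | a < truncModulus ρ Υ x}) =
      ENNReal.ofReal (a ^ (-α)) * Q (normalizedPath ρ Υ ⁻¹' E) := by
    intro a ha
    rw [hQ.measure_lt hXm hX hXc hρ hΥ ha hNE]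
    congr 2
    ext x
    simp only [Set.mem_ofPred_eq, Set.mem_preimage]
    rw [hρ.normalizedPath_smul Υ (one_pos.trans_le ha)]
  have hM : (Q.restrict (normalizedPath ρ Υ ⁻¹' E)).map (truncModulus ρ Υ) =
      Q (normalizedPath ρ Υ ⁻¹' E) • (powerMeasure α).restrict (Set.Ioi 1) := by
    refine Measure.ext_of_Ioi (fun a => ?_) ?_
    -- Neither side charges `(-∞, 1]`, so a level `a < 1` may be raised to `1`, where `hlt` applies.
    · have hpos : 0 < max a 1 := one_pos.trans_le (le_max_right _ _)
      rw [Measure.map_apply hr measurableSet_Ioi, Measure.restrict_apply (hr measurableSet_Ioi),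
        Measure.smul_apply, smul_eq_mul, Measure.restrict_apply measurableSet_Ioi,
        Set.Ioi_inter_Ioi, powerMeasure_Ioi hα hpos, mul_comm, ← hlt _ (le_max_right _ _)]
      refine measure_congr ?_
      filter_upwards [hae] with x hx
      refine propext ⟨fun h => ⟨h.2, max_lt h.1 hx⟩, fun h => ⟨?_, h.1⟩⟩
      exact lt_of_le_of_lt (le_max_left a 1) h.2
    · rw [Measure.map_apply hr MeasurableSet.univ, Set.preimage_univ, Measure.smul_apply,
        Measure.restrict_apply_univ, Measure.restrict_apply_univ, powerMeasure_Ioi hα one_pos]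
      simp
  have := congrArg (fun m : Measure ℝ => m s) hM
  simp only [Measure.smul_apply, smul_eq_mul] at this
  rw [Measure.map_apply hr hs, Measure.restrict_apply (hr hs)] at this
  rw [mul_comm, ← this]
  rfl

theorem measurable_smul_path {k d : ℕ} :
    Measurable fun (p : ℝ × FieldPath k d) (t : Idx k) => p.1 • p.2 t :=
  measurable_pi_lambda _ fun t => measurable_fst.smul ((measurable_pi_apply t).comp measurable_snd)

/-- A multiple of a tail field as a mixture of multiples of the spectral field. -/
theorem TailField.IsTailField.map_smul (hXm : ∀ t, Measurable (X t)) (hα : 0 < α)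
    (hX : IsRegularlyVaryingField P X α) (hXc : HasComparableTails P X) (hρ : IsModulus ρ)
    (hΥ : Υ.Nonempty) (hQ : IsTailField P X ρ Υ Q fun t x => x t) {ε : ℝ} (hε : 0 < ε) :
    Q.map (fun x t => ε • x t) = ENNReal.ofReal (ε ^ α) •
      (((powerMeasure α).restrict (Set.Ioi ε)).prod (Q.map (normalizedPath ρ Υ))).map
        fun p t => p.1 • p.2 t := by
  have hr := hρ.measurable_truncModulus Υ
  have hN := hρ.measurable_normalizedPath Υ
  have hmul : Measurable fun r : ℝ => ε * r := measurable_const_mul ε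
  have i0 : IsProbabilityMeasure (Q.map (normalizedPath ρ Υ)) :=
    Measure.isProbabilityMeasure_map hN.aemeasurable
  have h1 : (((powerMeasure α).restrict (Set.Ioi 1)).prod (Q.map (normalizedPath ρ Υ))).map
      (Prod.map (fun r => ε * r) id) = ENNReal.ofReal (ε ^ α) •
        ((powerMeasure α).restrict (Set.Ioi ε)).prod (Q.map (normalizedPath ρ Υ)) := by
    rw [← Measure.map_prod_map _ _ hmul measurable_id, Measure.map_id,
      map_mul_powerMeasure_restrict hα hε, Measure.prod_smul_left]
  rw [← Measure.map_smul, ← h1, ← hQ.map_polar hXm hα hX hXc hρ hΥ,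
    Measure.map_map (hmul.prodMap measurable_id) (hr.prodMk hN),
    Measure.map_map measurable_smul_path ((hmul.prodMap measurable_id).comp (hr.prodMk hN))]
  -- A path is the product of its modulus and its normalization only where the modulus is nonzero,
  -- hence almost surely.
  refine Measure.map_congr ?_
  filter_upwards [hQ.ae_one_lt hXm hX hXc hρ hΥ] with x hx
  funext t
  simp only [Function.comp_apply, Prod.map_apply, id, normalizedPath]
  rw [smul_smul, mul_assoc, mul_inv_cancel₀ (one_pos.trans hx).ne', mul_one]

end Polar

/-! ### Time change by stationarity -/

section TimeChange

variable {k d : ℕ} {Ω : Type*} [MeasurableSpace Ω] {P : Measure Ω} [IsProbabilityMeasure P]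
  {X : Idx k → Ω → Val d} {α : ℝ} {ρ : FieldPath k d → ℝ≥0∞} {Υ : Finset (Idx k)}
  {Q : Measure (FieldPath k d)} [IsProbabilityMeasure Q]

/-- Joint exceedances over two index sets. -/
theorem TailField.IsTailField.tendsto_setIntegral (hXm : ∀ t, Measurable (X t))
    (hX : IsRegularlyVaryingField P X α) (hXc : HasComparableTails P X) (hρ : IsModulus ρ)
    (hΥ : Υ.Nonempty) (hQ : IsTailField P X ρ Υ Q fun t x => x t) (S : Finset (Idx k))
    {u : ℝ} (hu : 0 < u) {g : FieldPath k d → ℝ} (hg : Continuous g) {C : ℝ}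
    (hC : ∀ x, |g x| ≤ C) {T : Finset (Idx k)}
    (hT : ∀ x y, (∀ t ∈ T, x t = y t) → g x = g y) :
    Tendsto (fun x : ℝ => (∫ ω in exceedance X ρ S (x * u) ∩ exceedance X ρ Υ x,
        g (fun t => x⁻¹ • X t ω) ∂P) / P.real (exceedance X ρ Υ x)) atTop
      (𝓝 (∫ x in {x | u < truncModulus ρ S x}, g x ∂Q)) := by
  have hSc := hρ.continuous_truncModulus S
  have hSm := hρ.measurable_truncModulus S
  have hpm : ∀ x : ℝ, Measurable fun ω (t : Idx k) => x⁻¹ • X t ω := fun x =>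
    measurable_pi_lambda _ fun t => (hXm t).const_smul x⁻¹
  let m : ℝ → Measure (FieldPath k d) := fun x =>
    P[|exceedance X ρ Υ x].map fun ω t => x⁻¹ • X t ω
  have hm : ∀ x, IsFiniteMeasure (m x) := fun x => by infer_instance
  have key : ∀ (h : FieldPath k d → ℝ), Continuous h → (∀ x, |h x| ≤ max 1 C) →
      (∀ x y, (∀ t ∈ T, x t = y t) → h x = h y) → ∀ φ : ℝ → ℝ, Continuous φ →
      (∀ t, |φ t| ≤ 1) → Tendsto (fun x => ∫ z, φ (truncModulus ρ S z) * h z ∂(m x)) atTop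
        (𝓝 (∫ z, φ (truncModulus ρ S z) * h z ∂Q)) := by
    intro h hh hhC hhT φ hφ hφ1
    have hc : Continuous fun z => φ (truncModulus ρ S z) * h z := (hφ.comp hSc).mul hh
    have hb : ∀ z, |φ (truncModulus ρ S z) * h z| ≤ 1 * max 1 C := by
      intro z
      rw [abs_mul]
      exact mul_le_mul (hφ1 _) (hhC z) (abs_nonneg _) zero_le_one
    refine (hQ.tendsto_of_dependsOn hc hb (T := S ∪ T) fun x y hxy => ?_).congr fun x => ?_
    · rw [truncModulus_congr ρ fun t ht => hxy t (Finset.mem_union_left _ ht),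
        hhT x y fun t ht => hxy t (Finset.mem_union_right _ ht)]
    · exact (integral_map (hpm x).aemeasurable hc.measurable.aestronglyMeasurable).symm
  -- The indicator of `{ρ_S > u}` is discontinuous, but its boundary level is null under `Q`. The
  -- conditional laws being finite, test functions may be cut off at `0`, just below `u`.
  have hmain := tendsto_setIntegral_of_cutoff (l := atTop) (m := m) (ν := Q) (f := g)
    (r := truncModulus ρ S) hg.measurable hSm hC hu
    (hQ.measure_level_eq_zero hXm hX hXc hρ hΥ S hu)
    (fun φ h1 h2 _ => by
      simpa using key (fun _ => 1) continuous_const (fun _ => by simp) (fun _ _ _ => rfl) φ h1 h2)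
    (fun φ h1 h2 _ => key g hg (fun x => (hC x).trans (le_max_right _ _)) hT φ h1 h2)
  refine hmain.congr' ?_
  filter_upwards [eventually_gt_atTop 0] with x hx
  have hA : MeasurableSet {z : FieldPath k d | u < truncModulus ρ S z} :=
    measurableSet_lt measurable_const hSm
  have hpre : (fun ω (t : Idx k) => x⁻¹ • X t ω) ⁻¹' {z | u < truncModulus ρ S z} =
      exceedance X ρ S (x * u) := by
    ext ω
    simp only [Set.mem_preimage, Set.mem_ofPred_eq, exceedance]
    rw [hρ.truncModulus_smul S (inv_nonneg.2 hx.le) fun t => X t ω, inv_mul_eq_div,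
      lt_div_iff₀ hx, mul_comm]
  have hB := measurableSet_exceedance hXm hρ S (x * u)
  rw [setIntegral_map hA hg.measurable.aestronglyMeasurable (hpm x).aemeasurable, hpre,
    ← integral_indicator hB, integral_cond_eq_div, setIntegral_indicator hB, Set.inter_comm]

/-- The translate of a path. -/
def shiftPath {k d : ℕ} (s : Idx k) (x : FieldPath k d) : FieldPath k d := fun t => x (t - s)

theorem measurable_shiftPath (s : Idx k) : Measurable (shiftPath (d := d) s) :=
  measurable_pi_lambda _ fun t => measurable_pi_apply (t - s)

theorem continuous_shiftPath (s : Idx k) : Continuous (shiftPath (d := d) s) :=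
  continuous_pi fun t => continuous_apply (t - s)

/-- Together with `truncModulus_shiftPath`: translation by `s` carries the moduli over `Υ + s` and
`Υ` to those over `Υ` and `Υ - s`. This exchanges the conditioning event with the additional one. -/
theorem TailField.IsTranslationInvariant.truncModulus_translate_shiftPath
    (hinv : IsTranslationInvariant ρ) (Υ : Finset (Idx k)) (s : Idx k) (x : FieldPath k d) :
    truncModulus ρ (translate Υ s) (shiftPath s x) = truncModulus ρ Υ x := by
  rw [hinv.truncModulus_translate]
  congr 1
  funext t
  simp [shiftPath]

theorem TailField.IsTranslationInvariant.truncModulus_shiftPath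
    (hinv : IsTranslationInvariant ρ) (Υ : Finset (Idx k)) (s : Idx k) (x : FieldPath k d) :
    truncModulus ρ Υ (shiftPath s x) = truncModulus ρ (translate Υ (-s)) x := by
  rw [hinv.truncModulus_translate]
  rfl

/-- Time change at a positive level. -/
theorem TailField.IsTailField.map_shiftPath_restrict (hXm : ∀ t, Measurable (X t))
    (hX : IsRegularlyVaryingField P X α) (hXs : IsStationaryField P X) (hρ : IsModulus ρ)
    (hinv : IsTranslationInvariant ρ) (hΥ : Υ.Nonempty)
    (hQ : IsTailField P X ρ Υ Q fun t x => x t) (s : Idx k) {ε : ℝ} (hε : 0 < ε) :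
    (Q.restrict {x | ε < truncModulus ρ (translate Υ (-s)) x}).map (shiftPath s) =
      ENNReal.ofReal (ε ^ (-α)) •
        (Q.map fun x t => ε • x t).restrict {x | 1 < truncModulus ρ (translate Υ s) x} := by
  have hXc := hXs.hasComparableTails hXm
  have hpath : Measurable fun ω (t : Idx k) => X t ω := measurable_pi_lambda _ hXm
  have hsm : Measurable fun (x : FieldPath k d) t => ε • x t :=
    measurable_pi_lambda _ fun t => (measurable_pi_apply t).const_smul ε
  have hA : MeasurableSet {x | 1 < truncModulus ρ (translate Υ s) x} :=
    measurableSet_lt measurable_const (hρ.measurable_truncModulus _)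
  have i1 : IsFiniteMeasure (ENNReal.ofReal (ε ^ (-α)) •
      (Q.map fun (x : FieldPath k d) t => ε • x t).restrict
        {x | 1 < truncModulus ρ (translate Υ s) x}) :=
    Measure.smul_finite _ ENNReal.ofReal_ne_top
  refine ext_of_forall_integral_restrict_eq ∅ fun T _ f => ?_
  have hTc : Continuous (T.restrict : FieldPath k d → (T → Val d)) := Finset.continuous_restrict T
  have hgc : Continuous fun x : FieldPath k d => f (T.restrict (π := fun _ => Val d) x) := f.continuous.comp hTc
  obtain ⟨g, hg⟩ : ∃ g : FieldPath k d → ℝ, g = fun x => f (T.restrict (π := fun _ => Val d) x) := ⟨_, rfl⟩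
  rw [← hg] at hgc
  have hgC : ∀ x, |g x| ≤ ‖f‖ := fun x => by rw [hg]; exact f.norm_coe_le_norm _
  have hgT : ∀ x y : FieldPath k d, (∀ t ∈ T, x t = y t) → g x = g y := fun x y hxy => by
    rw [hg]
    exact congrArg f (funext fun t => hxy t t.2)
  change ∫ x, (fun x => f (T.restrict (π := fun _ => Val d) x)) x ∂_ = ∫ x, (fun x => f (T.restrict (π := fun _ => Val d) x)) x ∂_
  rw [← hg]
  have hgm := hgc.measurable
  rw [integral_map (measurable_shiftPath s).aemeasurable hgm.aestronglyMeasurable,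
    integral_smul_measure, setIntegral_map hA hgm.aestronglyMeasurable hsm.aemeasurable,
    ENNReal.toReal_ofReal (Real.rpow_nonneg hε.le _), smul_eq_mul]
  have hpre : (fun (x : FieldPath k d) t => ε • x t) ⁻¹'
      {x | 1 < truncModulus ρ (translate Υ s) x} =
      {x | ε⁻¹ < truncModulus ρ (translate Υ s) x} := by
    ext x
    simp only [Set.mem_preimage, Set.mem_ofPred_eq]
    rw [hρ.truncModulus_smul _ hε.le, inv_lt_iff_one_lt_mul₀ hε, mul_comm]
  rw [hpre]
  have hsmc : Continuous fun (x : FieldPath k d) (t : Idx k) => ε • x t :=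
    continuous_pi fun t => (continuous_apply t).const_smul ε
  have l1 := hQ.tendsto_setIntegral hXm hX hXc hρ hΥ (translate Υ (-s)) hε
    (g := fun x => g (shiftPath s x)) (hgc.comp (continuous_shiftPath s)) (fun x => hgC _)
    (T := translate T (-s)) fun x y hxy => hgT _ _ fun t ht => hxy _ (by
      rw [translate, Finset.mem_image]
      exact ⟨t, ht, (sub_eq_add_neg t s).symm⟩)
  have l2 := hQ.tendsto_setIntegral hXm hX hXc hρ hΥ (translate Υ s) (inv_pos.2 hε)
    (g := fun x => g fun t => ε • x t) (hgc.comp hsmc) (fun x => hgC _)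
    (T := T) fun x y hxy => hgT _ _ fun t ht => by rw [hxy t ht]
  have hmul : Tendsto (fun x : ℝ => x * ε) atTop atTop := tendsto_id.atTop_mul_const hε
  -- Taken at scale `x * ε`, the event of `l2` is `ρ_{Υ+s}(X) > x`, `ρ_Υ(X) > x ε`, the translate of
  -- the event of `l1` at scale `x`. The exceedance ratio restores the common normalization and
  -- contributes `ε ^ (-α)`.
  have l3 := (l2.comp hmul).mul (tendsto_exceedance_ratio hXm hX hXc hρ hΥ hε)
  rw [mul_comm]
  refine tendsto_nhds_unique l1 (l3.congr' ?_)
  filter_upwards [hmul.eventually (eventually_exceedance_ne_zero hXm hX hXc hρ hΥ),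
    eventually_gt_atTop 0] with x hx hx0
  have hx' : P.real (exceedance X ρ Υ (x * ε)) ≠ 0 :=
    (ENNReal.toReal_pos hx (measure_ne_top _ _)).ne'
  simp only [Function.comp_apply]
  rw [div_mul_div_cancel₀ hx', mul_inv_cancel_right₀ hε.ne']
  congr 1
  -- stationarity
  let B : Set (FieldPath k d) :=
    {z | x * ε < truncModulus ρ Υ z} ∩ {z | x < truncModulus ρ (translate Υ s) z}
  have hB : MeasurableSet B :=
    (measurableSet_lt measurable_const (hρ.measurable_truncModulus _)).inter
      (measurableSet_lt measurable_const (hρ.measurable_truncModulus _))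
  have hH : Measurable (B.indicator fun z => g fun t => x⁻¹ • z t) :=
    Measurable.indicator (hgm.comp (measurable_pi_lambda _ fun t =>
      (measurable_pi_apply t).const_smul x⁻¹)) hB
  have hst := congrArg (fun L : Measure (FieldPath k d) =>
    ∫ z, B.indicator (fun z => g fun t => x⁻¹ • z t) z ∂L) (hXs (-s))
  beta_reduce at hst
  rw [integral_map (measurable_pi_lambda _ fun t => hXm (t + -s)).aemeasurable
    hH.aestronglyMeasurable, integral_map hpath.aemeasurable hH.aestronglyMeasurable] at hst
  rw [← integral_indicator ((measurableSet_exceedance hXm hρ _ _).inter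
      (measurableSet_exceedance hXm hρ _ _)), ← integral_indicator
      ((measurableSet_exceedance hXm hρ _ _).inter (measurableSet_exceedance hXm hρ _ _))]
  refine (Eq.trans ?_ hst.symm).trans ?_
  · refine integral_congr_ae (ae_of_all _ fun ω => ?_)
    beta_reduce
    have hiff : ω ∈ exceedance X ρ (translate Υ s) x ∩ exceedance X ρ Υ (x * ε) ↔
        (fun t => X t ω) ∈ B := And.comm
    by_cases h : (fun t => X t ω) ∈ B
    · rw [Set.indicator_of_mem h, Set.indicator_of_mem (hiff.2 h)]
      congr 1
      funext t
      rw [smul_smul, mul_inv, mul_comm x⁻¹, mul_inv_cancel_left₀ hε.ne']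
    · rw [Set.indicator_of_notMem h, Set.indicator_of_notMem (fun h' => h (hiff.1 h'))]
  · refine integral_congr_ae (ae_of_all _ fun ω => ?_)
    beta_reduce
    have hsh : (fun t => X (t + -s) ω) = shiftPath s fun t => X t ω := by
      funext t
      rw [shiftPath, sub_eq_add_neg]
    have hiff : ω ∈ exceedance X ρ (translate Υ (-s)) (x * ε) ∩ exceedance X ρ Υ x ↔
        (fun t => X (t + -s) ω) ∈ B := by
      rw [hsh]
      simp only [B, Set.mem_inter_iff, Set.mem_ofPred_eq, exceedance]
      rw [hinv.truncModulus_translate_shiftPath, hinv.truncModulus_shiftPath]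
    by_cases h : (fun t => X (t + -s) ω) ∈ B
    · rw [Set.indicator_of_mem h, Set.indicator_of_mem (hiff.2 h)]
      congr 1
    · rw [Set.indicator_of_notMem h, Set.indicator_of_notMem (fun h' => h (hiff.1 h'))]

/-- Time change formula, as an identity between measures. -/
theorem TailField.IsTailField.map_shiftPath_restrict_ne_zero (hXm : ∀ t, Measurable (X t))
    (hα : 0 < α) (hX : IsRegularlyVaryingField P X α) (hXs : IsStationaryField P X)
    (hρ : IsModulus ρ) (hinv : IsTranslationInvariant ρ) (hΥ : Υ.Nonempty)
    (hQ : IsTailField P X ρ Υ Q fun t x => x t) (s : Idx k) :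
    (Q.restrict {x | truncModulus ρ (translate Υ (-s)) x ≠ 0}).map (shiftPath s) =
      (((powerMeasure α).prod (Q.map (normalizedPath ρ Υ))).map
        fun p t => p.1 • p.2 t).restrict {x | 1 < truncModulus ρ (translate Υ s) x} := by
  have hXc := hXs.hasComparableTails hXm
  have hA : MeasurableSet {x | 1 < truncModulus ρ (translate Υ s) x} :=
    measurableSet_lt measurable_const (hρ.measurable_truncModulus _)
  -- Levels decreasing to `0`. Both sides are measures of increasing sets, so continuity from below
  -- suffices although the power measure has infinite mass near `0`.
  let e : ℕ → ℝ := fun n => 1 / ((n : ℝ) + 1)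
  have he0 : ∀ n, 0 < e n := fun n => Nat.one_div_pos_of_nat
  have hanti : ∀ {i j : ℕ}, i ≤ j → e j ≤ e i := fun h => Nat.one_div_le_one_div h
  have hex : ∀ {r : ℝ}, 0 < r → ∃ n, e n < r := fun h => exists_nat_one_div_lt h
  ext E hE
  have key : ∀ n, Q ({x | e n < truncModulus ρ (translate Υ (-s)) x} ∩ shiftPath s ⁻¹' E) =
      ((powerMeasure α).prod (Q.map (normalizedPath ρ Υ))) (Set.Ioi (e n) ×ˢ Set.univ ∩
        (fun (p : ℝ × FieldPath k d) t => p.1 • p.2 t) ⁻¹'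
          (E ∩ {x | 1 < truncModulus ρ (translate Υ s) x})) := by
    intro n
    have hB : MeasurableSet {x | e n < truncModulus ρ (translate Υ (-s)) x} :=
      measurableSet_lt measurable_const (hρ.measurable_truncModulus _)
    have h1 := congrArg (fun m : Measure (FieldPath k d) => m E)
      (hQ.map_shiftPath_restrict hXm hX hXs hρ hinv hΥ s (he0 n))
    rw [hQ.map_smul hXm hα hX hXc hρ hΥ (he0 n), Measure.restrict_smul, smul_smul,
      ← ENNReal.ofReal_mul (Real.rpow_nonneg (he0 n).le _), ← Real.rpow_add (he0 n),
      neg_add_cancel, Real.rpow_zero, ENNReal.ofReal_one, one_smul,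
      Measure.map_apply (measurable_shiftPath s) hE,
      Measure.restrict_apply (measurable_shiftPath s hE), Measure.restrict_apply hE,
      Measure.map_apply measurable_smul_path (hE.inter hA),
      Measure.restrict_prod_eq_prod_univ, Measure.restrict_apply
        (measurable_smul_path (hE.inter hA))] at h1
    rw [Set.inter_comm, h1, Set.inter_comm]
  have l1 : Tendsto (fun n => Q ({x | e n < truncModulus ρ (translate Υ (-s)) x} ∩
      shiftPath s ⁻¹' E)) atTop (𝓝 (Q (⋃ n, {x | e n < truncModulus ρ (translate Υ (-s)) x} ∩
      shiftPath s ⁻¹' E))) :=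
    tendsto_measure_iUnion_atTop fun i j hij x hx => ⟨(hanti hij).trans_lt hx.1, hx.2⟩
  have l2 : Tendsto (fun n => ((powerMeasure α).prod (Q.map (normalizedPath ρ Υ)))
      (Set.Ioi (e n) ×ˢ Set.univ ∩ (fun (p : ℝ × FieldPath k d) t => p.1 • p.2 t) ⁻¹'
          (E ∩ {x | 1 < truncModulus ρ (translate Υ s) x}))) atTop
      (𝓝 (((powerMeasure α).prod (Q.map (normalizedPath ρ Υ))) (⋃ n,
      (Set.Ioi (e n) ×ˢ Set.univ ∩ (fun (p : ℝ × FieldPath k d) t => p.1 • p.2 t) ⁻¹'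
          (E ∩ {x | 1 < truncModulus ρ (translate Υ s) x}))))) :=
    tendsto_measure_iUnion_atTop fun i j hij p hp =>
      ⟨⟨(hanti hij).trans_lt hp.1.1, trivial⟩, hp.2⟩
  have h3 := tendsto_nhds_unique (l1.congr key) l2
  have u1 : (⋃ n, {x | e n < truncModulus ρ (translate Υ (-s)) x} ∩ shiftPath s ⁻¹' E) =
      shiftPath s ⁻¹' E ∩ {x | truncModulus ρ (translate Υ (-s)) x ≠ 0} := by
    ext x
    simp only [Set.mem_iUnion, Set.mem_inter_iff, Set.mem_ofPred_eq]
    constructor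
    · rintro ⟨n, h, h'⟩
      exact ⟨h', ((he0 n).trans h).ne'⟩
    · rintro ⟨h', h⟩
      obtain ⟨n, hn⟩ := hex (lt_of_le_of_ne (truncModulus_nonneg ρ _ x) (Ne.symm h))
      exact ⟨n, hn, h'⟩
  have hne : MeasurableSet {x | truncModulus ρ (translate Υ (-s)) x ≠ 0} :=
    (hρ.measurable_truncModulus _) (measurableSet_singleton 0).compl
  have hpos : ∀ᵐ p ∂((powerMeasure α).prod (Q.map (normalizedPath ρ Υ))), 0 < p.1 :=
    Measure.quasiMeasurePreserving_fst.ae (ae_powerMeasure_pos α)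
  rw [Measure.map_apply (measurable_shiftPath s) hE,
    Measure.restrict_apply (measurable_shiftPath s hE), ← u1, h3, Measure.restrict_apply hE,
    Measure.map_apply measurable_smul_path (hE.inter hA)]
  -- The sets `{r > e n}` exhaust `{r > 0}`, which has full measure.
  refine measure_congr ?_
  filter_upwards [hpos] with p hp
  refine propext ⟨fun h => ?_, fun h => ?_⟩
  · obtain ⟨n, hn⟩ := Set.mem_iUnion.1 h
    exact hn.2
  · obtain ⟨n, hn⟩ := hex hp
    exact Set.mem_iUnion.2 ⟨n, ⟨hn, trivial⟩, h⟩

end TimeChange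

/-! ### Independence and integrated time change formulas -/

section Formulas

variable {k d : ℕ} {Ω : Type*} [MeasurableSpace Ω] {P : Measure Ω} [IsProbabilityMeasure P]
  {X : Idx k → Ω → Val d} {α : ℝ} {ρ : FieldPath k d → ℝ≥0∞} {Υ : Finset (Idx k)}
  {Q : Measure (FieldPath k d)} [IsProbabilityMeasure Q]

/-- The modulus and the normalization of a tail field are independent. -/
theorem TailField.IsTailField.indepFun (hXm : ∀ t, Measurable (X t)) (hα : 0 < α)
    (hX : IsRegularlyVaryingField P X α) (hXc : HasComparableTails P X) (hρ : IsModulus ρ)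
    (hΥ : Υ.Nonempty) {Ω' : Type*} [MeasurableSpace Ω'] {P' : Measure Ω'} [IsProbabilityMeasure P']
    {Y : Idx k → Ω' → Val d} (hY : IsTailField P X ρ Υ P' Y) :
    IndepFun (fun ω => truncModulus ρ Υ fun t => Y t ω)
      (fun ω => normalizedPath ρ Υ fun t => Y t ω) P' := by
  have hYm : Measurable fun ω t => Y t ω := measurable_pi_lambda _ hY.1
  have hr := hρ.measurable_truncModulus Υ
  have hN := hρ.measurable_normalizedPath Υ
  have hQp : IsProbabilityMeasure (P'.map fun ω t => Y t ω) :=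
    Measure.isProbabilityMeasure_map hYm.aemeasurable
  have i0 : IsProbabilityMeasure ((P'.map fun ω t => Y t ω).map (normalizedPath ρ Υ)) :=
    Measure.isProbabilityMeasure_map hN.aemeasurable
  have hpol := hY.map.map_polar hXm hα hX hXc hρ hΥ
  have h1 : (P'.map fun ω t => Y t ω).map (truncModulus ρ Υ) =
      (powerMeasure α).restrict (Set.Ioi 1) := by
    have h := congrArg (fun m : Measure (ℝ × FieldPath k d) => m.map Prod.fst) hpol
    beta_reduce at h
    rw [Measure.map_map measurable_fst (hr.prodMk hN), Measure.map_fst_prod, measure_univ,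
      one_smul] at h
    exact h
  refine (indepFun_iff_map_prod_eq_prod_map_map (hr.comp hYm).aemeasurable
    (hN.comp hYm).aemeasurable).2 ?_
  rw [← h1, Measure.map_map hr hYm, Measure.map_map hN hYm,
    Measure.map_map (hr.prodMk hN) hYm] at hpol
  exact hpol

/-- Time change formula, integrated form. -/
theorem TailField.IsTailField.integral_shiftPath (hXm : ∀ t, Measurable (X t))
    (hα : 0 < α) (hX : IsRegularlyVaryingField P X α) (hXs : IsStationaryField P X)
    (hρ : IsModulus ρ) (hinv : IsTranslationInvariant ρ) (hΥ : Υ.Nonempty)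
    (hQ : IsTailField P X ρ Υ Q fun t x => x t) (s : Idx k) {g : FieldPath k d → ℝ}
    (hg : Measurable g) {C : ℝ} (hC : ∀ x, |g x| ≤ C) :
    Integrable (fun p : ℝ × FieldPath k d =>
        {p : ℝ × FieldPath k d | 1 < p.1 * truncModulus ρ (translate Υ s) p.2}.indicator
          (fun p => g fun t => p.1 • p.2 t) p)
      ((powerMeasure α).prod (Q.map (normalizedPath ρ Υ))) ∧
    ∫ x in {x | truncModulus ρ (translate Υ (-s)) x ≠ 0}, g (shiftPath s x) ∂Q =
      ∫ p, {p : ℝ × FieldPath k d | 1 < p.1 * truncModulus ρ (translate Υ s) p.2}.indicator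
          (fun p => g fun t => p.1 • p.2 t) p
        ∂((powerMeasure α).prod (Q.map (normalizedPath ρ Υ))) := by
  have hid := hQ.map_shiftPath_restrict_ne_zero hXm hα hX hXs hρ hinv hΥ s
  have hA : MeasurableSet {x | 1 < truncModulus ρ (translate Υ s) x} :=
    measurableSet_lt measurable_const (hρ.measurable_truncModulus _)
  -- Absolute convergence is immediate on the left: a bounded function under the image of a finite
  -- measure. The identity of measures transports it to the infinite product measure on the right.
  have hgi : Integrable g ((Q.restrict {x | truncModulus ρ (translate Υ (-s)) x ≠ 0}).map
      (shiftPath s)) := Integrable.of_bound hg.aestronglyMeasurable C (ae_of_all _ hC)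
  have hgA : Measurable ({x | 1 < truncModulus ρ (translate Υ s) x}.indicator g) :=
    hg.indicator hA
  have hpos : ∀ᵐ p ∂((powerMeasure α).prod (Q.map (normalizedPath ρ Υ))), 0 < p.1 :=
    Measure.quasiMeasurePreserving_fst.ae (ae_powerMeasure_pos α)
  have hcongr : ({x | 1 < truncModulus ρ (translate Υ s) x}.indicator g ∘
      fun (p : ℝ × FieldPath k d) t => p.1 • p.2 t) =ᵐ[(powerMeasure α).prod
        (Q.map (normalizedPath ρ Υ))] fun p : ℝ × FieldPath k d =>
        {p : ℝ × FieldPath k d | 1 < p.1 * truncModulus ρ (translate Υ s) p.2}.indicator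
          (fun p => g fun t => p.1 • p.2 t) p := by
    filter_upwards [hpos] with p hp
    simp only [Function.comp_apply, Set.indicator, Set.mem_ofPred_eq,
      hρ.truncModulus_smul _ hp.le]
  constructor
  · rw [hid] at hgi
    refine Integrable.congr ?_ hcongr
    exact (integrable_map_measure hgA.aestronglyMeasurable measurable_smul_path.aemeasurable).1
      ((integrable_indicator_iff hA).2 hgi)
  · rw [← integral_map (measurable_shiftPath s).aemeasurable hg.aestronglyMeasurable, hid,
      ← integral_indicator hA, integral_map measurable_smul_path.aemeasurable
        hgA.aestronglyMeasurable]
    exact integral_congr_ae hcongr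

/-- The radial integral behind the weight in (iii). For `w = 0` both sides vanish because `0 ^ α =
0`, which matches the convention that the integrand of (iii) is then `0`. -/
theorem integral_indicator_one_lt_mul (hα : 0 < α) {w : ℝ} (hw : 0 ≤ w) (c : ℝ) :
    ∫ r, {r : ℝ | 1 < r * w}.indicator (fun _ => c) r ∂powerMeasure α = c * w ^ α := by
  rcases hw.eq_or_lt with h0 | h0
  · rw [← h0, Real.zero_rpow hα.ne']
    simp
  · have hset : {r : ℝ | 1 < r * w} = Set.Ioi w⁻¹ := by
      ext r
      simp only [Set.mem_ofPred_eq, Set.mem_Ioi]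
      rw [inv_lt_iff_one_lt_mul₀ h0]
    rw [hset, integral_indicator measurableSet_Ioi, setIntegral_const, Measure.real,
      powerMeasure_Ioi hα (inv_pos.2 h0), smul_eq_mul, Real.inv_rpow hw, Real.rpow_neg hw, inv_inv,
      ENNReal.toReal_ofReal (Real.rpow_nonneg hw _), mul_comm]

end Formulas

/-! ### The main theorem -/

theorem proposition4p4 {k d : ℕ} {Ω : Type*} [MeasurableSpace Ω] (P : Measure Ω)
    [IsProbabilityMeasure P] (X : Idx k → Ω → Val d) (hXm : ∀ t, Measurable (X t))
    (α : ℝ) (hα : 0 < α) (hX : IsRegularlyVaryingField P X α) (hXc : HasComparableTails P X)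
    (ρ : FieldPath k d → ℝ≥0∞) (hρ : IsModulus ρ) (Υ : Finset (Idx k)) (hΥ : Υ.Nonempty) :
    -- existence of the tail field, with Pareto modulus
    (∃ (Ω' : Type) (_ : MeasurableSpace Ω') (P' : Measure Ω') (_ : IsProbabilityMeasure P')
      (Y : Idx k → Ω' → Val d), IsTailField P X ρ Υ P' Y ∧
        ∀ y : ℝ, 1 ≤ y → P'.real {ω | y < truncModulus ρ Υ fun t => Y t ω} = y ^ (-α)) ∧
    -- existence of the spectral field
    (∃ (Ω' : Type) (_ : MeasurableSpace Ω') (P' : Measure Ω') (_ : IsProbabilityMeasure P')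
      (Θ : Idx k → Ω' → Val d), IsSpectralField P X ρ Υ P' Θ) ∧
    -- properties of every tail field `Y` and of `Θ = Y / ρ_Υ(Y)`
    ∀ (Ω' : Type*) [MeasurableSpace Ω'] (P' : Measure Ω') [IsProbabilityMeasure P']
      (Y Θ : Idx k → Ω' → Val d), IsTailField P X ρ Υ P' Y → Θ = normalized Y ρ Υ →
      (∀ y : ℝ, 1 ≤ y → P'.real {ω | y < truncModulus ρ Υ fun t => Y t ω} = y ^ (-α)) ∧
      IsSpectralField P X ρ Υ P' Θ ∧
      IndepFun (fun ω => truncModulus ρ Υ fun t => Y t ω) (fun ω (t : Idx k) => Θ t ω) P' ∧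
      (IsStationaryField P X → IsTranslationInvariant ρ →
        ∀ (g : FieldPath k d → ℝ), Measurable g → (∃ C : ℝ, ∀ x, |g x| ≤ C) → ∀ s : Idx k,
        -- time change formula for the tail field
        (Integrable (fun r : ℝ => ∫ ω, Set.indicator
            {ω | 1 < r * truncModulus ρ (translate Υ s) fun t => Θ t ω}
            (fun ω => g fun t => r • Θ t ω) ω ∂P') (powerMeasure α) ∧
          ∫ ω, Set.indicator {ω | truncModulus ρ (translate Υ (-s)) (fun t => Y t ω) ≠ 0}
            (fun ω => g fun t => Y (t - s) ω) ω ∂P' =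
          ∫ r, ∫ ω, Set.indicator
            {ω | 1 < r * truncModulus ρ (translate Υ s) fun t => Θ t ω}
            (fun ω => g fun t => r • Θ t ω) ω ∂P' ∂powerMeasure α) ∧
        -- time change formula for the spectral field
        (Integrable (fun ω =>
            g (fun t => (truncModulus ρ (translate Υ s) fun u => Θ u ω)⁻¹ • Θ t ω) *
              (truncModulus ρ (translate Υ s) fun u => Θ u ω) ^ α) P' ∧
          ∫ ω, Set.indicator {ω | truncModulus ρ (translate Υ (-s)) (fun t => Θ t ω) ≠ 0}
            (fun ω => g fun t => Θ (t - s) ω) ω ∂P' =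
          ∫ ω, g (fun t => (truncModulus ρ (translate Υ s) fun u => Θ u ω)⁻¹ • Θ t ω) *
              (truncModulus ρ (translate Υ s) fun u => Θ u ω) ^ α ∂P')) := by
  have hpareto : ∀ {Q : Measure (FieldPath k d)} [IsProbabilityMeasure Q],
      (IsTailField P X ρ Υ Q fun t x => x t) → ∀ y : ℝ, 1 ≤ y →
        Q.real {x | y < truncModulus ρ Υ x} = y ^ (-α) := by
    intro Q _ hQ y hy
    rw [Measure.real, hQ.measure_modulus hXm hX hXc hρ hΥ hy,
      ENNReal.toReal_ofReal (Real.rpow_nonneg (zero_le_one.trans hy) _)]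
  obtain ⟨Q₀, hQ₀p, hQ₀⟩ := exists_tailField hXm hX hXc hρ hΥ
  refine ⟨⟨FieldPath k d, inferInstance, Q₀, hQ₀p, fun t x => x t, hQ₀, hpareto hQ₀⟩,
    ⟨FieldPath k d, inferInstance, Q₀, hQ₀p, _, hQ₀.isSpectralField hXm hX hXc hρ hΥ⟩, ?_⟩
  intro Ω' _ P' _ Y Θ hY hΘ
  subst hΘ
  have hYm : Measurable fun ω t => Y t ω := measurable_pi_lambda _ hY.1
  have hN := hρ.measurable_normalizedPath Υ
  have hNY : Measurable fun ω => normalizedPath ρ Υ fun t => Y t ω := hN.comp hYm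
  have hQp : IsProbabilityMeasure (P'.map fun ω t => Y t ω) :=
    Measure.isProbabilityMeasure_map hYm.aemeasurable
  have hQ := hY.map
  refine ⟨fun y hy => ?_, hY.isSpectralField hXm hX hXc hρ hΥ,
    hY.indepFun hXm hα hX hXc hρ hΥ, ?_⟩
  · rw [← hpareto hQ y hy, Measure.real, Measure.real, Measure.map_apply hYm
      (measurableSet_lt measurable_const (hρ.measurable_truncModulus Υ))]
    rfl
  intro hXs hinv g hg ⟨C, hC⟩ s
  have i0 : IsProbabilityMeasure ((P'.map fun ω t => Y t ω).map (normalizedPath ρ Υ)) :=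
    Measure.isProbabilityMeasure_map hN.aemeasurable
  have hΛ : (P'.map fun ω t => Y t ω).map (normalizedPath ρ Υ) =
      P'.map fun ω => normalizedPath ρ Υ fun t => Y t ω := Measure.map_map hN hYm
  have hS := hρ.measurable_truncModulus (translate Υ s)
  have hne : MeasurableSet {x | truncModulus ρ (translate Υ (-s)) x ≠ 0} :=
    (hρ.measurable_truncModulus _) (measurableSet_singleton 0).compl
  have hleft : ∀ h : FieldPath k d → ℝ, Measurable h →
      ∫ x in {x | truncModulus ρ (translate Υ (-s)) x ≠ 0}, h x ∂(P'.map fun ω t => Y t ω) =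
        ∫ ω, {x | truncModulus ρ (translate Υ (-s)) x ≠ 0}.indicator h (fun t => Y t ω) ∂P' := by
    intro h hh
    rw [← integral_indicator hne, integral_map hYm.aemeasurable
      (hh.indicator hne).aestronglyMeasurable]
  constructor
  · obtain ⟨hint, heq⟩ := hQ.integral_shiftPath hXm hα hX hXs hρ hinv hΥ s hg hC
    have hinner : ∀ r : ℝ, ∫ θ, {p : ℝ × FieldPath k d | 1 < p.1 *
          truncModulus ρ (translate Υ s) p.2}.indicator (fun p => g fun t => p.1 • p.2 t) (r, θ)
          ∂((P'.map fun ω t => Y t ω).map (normalizedPath ρ Υ)) =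
        ∫ ω, Set.indicator {ω | 1 < r * truncModulus ρ (translate Υ s) fun t =>
          normalized Y ρ Υ t ω} (fun ω => g fun t => r • normalized Y ρ Υ t ω) ω ∂P' := by
      intro r
      have hm : Measurable fun θ : FieldPath k d => {p : ℝ × FieldPath k d | 1 < p.1 *
          truncModulus ρ (translate Υ s) p.2}.indicator
            (fun p => g fun t => p.1 • p.2 t) (r, θ) :=
        (Measurable.indicator (hg.comp measurable_smul_path) (measurableSet_lt measurable_const
          (measurable_fst.mul (hS.comp measurable_snd)))).comp measurable_prodMk_left
      rw [hΛ, integral_map hNY.aemeasurable hm.aestronglyMeasurable]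
      rfl
    refine ⟨hint.integral_prod_left.congr (ae_of_all _ hinner), ?_⟩
    rw [integral_prod _ hint] at heq
    exact ((hleft _ (hg.comp (measurable_shiftPath s))).symm.trans heq).trans (integral_congr_ae (ae_of_all _ hinner))
  -- Normalization by `ρ_{Υ+s}` is scale invariant, so integrating in `r` first leaves only the mass
  -- of `{r ρ_{Υ+s}(Θ) > 1}`.
  · obtain ⟨hint, heq⟩ := hQ.integral_shiftPath hXm hα hX hXs hρ hinv hΥ s
      (g := fun x => g (normalizedPath ρ (translate Υ s) x))
      (hg.comp (hρ.measurable_normalizedPath _)) fun x => hC _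
    have hinner : ∀ θ : FieldPath k d, ∫ r, {p : ℝ × FieldPath k d | 1 < p.1 *
          truncModulus ρ (translate Υ s) p.2}.indicator
            (fun p => g (normalizedPath ρ (translate Υ s) fun t => p.1 • p.2 t)) (r, θ)
          ∂powerMeasure α =
        g (normalizedPath ρ (translate Υ s) θ) * truncModulus ρ (translate Υ s) θ ^ α := by
      intro θ
      rw [← integral_indicator_one_lt_mul hα (truncModulus_nonneg ρ _ θ)]
      refine integral_congr_ae ?_
      filter_upwards [ae_powerMeasure_pos α] with r hr
      simp only [Set.indicator, Set.mem_ofPred_eq, hρ.normalizedPath_smul _ hr]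
    have hm : Measurable fun θ : FieldPath k d =>
        g (normalizedPath ρ (translate Υ s) θ) * truncModulus ρ (translate Υ s) θ ^ α :=
      (hg.comp (hρ.measurable_normalizedPath _)).mul (hS.pow_const α)
    have hintr := hint.integral_prod_right.congr (ae_of_all _ hinner)
    rw [integral_prod_symm _ hint, integral_congr_ae (ae_of_all _ hinner), hΛ,
      integral_map hNY.aemeasurable hm.aestronglyMeasurable] at heq
    have heq' := (hleft _ (hg.comp ((hρ.measurable_normalizedPath (translate Υ s)).comp
      (measurable_shiftPath s)))).symm.trans heq
    rw [hΛ] at hintr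
    refine ⟨(integrable_map_measure hm.aestronglyMeasurable hNY.aemeasurable).1 hintr,
      Eq.trans (integral_congr_ae ?_) heq'⟩
    -- Almost surely `Θ` is a positive multiple of `Y`, so the two nonvanishing events agree. The
    -- translated `Y` has `ρ_{Υ+s}` equal to `ρ_Υ(Y)`, so its normalization is the translated `Θ`.
    filter_upwards [ae_of_ae_map hYm.aemeasurable (hQ.ae_one_lt hXm hX hXc hρ hΥ)] with ω hω
    have hpos : 0 < (truncModulus ρ Υ fun t => Y t ω)⁻¹ := inv_pos.2 (one_pos.trans hω)
    have hiff : truncModulus ρ (translate Υ (-s)) (fun t => normalized Y ρ Υ t ω) ≠ 0 ↔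
        truncModulus ρ (translate Υ (-s)) (fun t => Y t ω) ≠ 0 := by
      have := hρ.truncModulus_smul (translate Υ (-s)) hpos.le fun t => Y t ω
      rw [show (fun t => normalized Y ρ Υ t ω) =
        fun t => (truncModulus ρ Υ fun t => Y t ω)⁻¹ • Y t ω from rfl, this]
      simp [hpos.ne']
    have hshift : (fun t => normalized Y ρ Υ (t - s) ω) =
        normalizedPath ρ (translate Υ s) (shiftPath s fun t => Y t ω) := by
      funext t
      rw [normalizedPath, hinv.truncModulus_translate_shiftPath]
      rfl
    simp only [Set.indicator, Set.mem_ofPred_eq, hiff, hshift, Function.comp_apply]
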